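/- There is a function $f\colon\mathbb N\times\mathbb N\to\mathbb N$ with the following property. Let $L$ be a (right) Leibniz algebra, of possibly infinite dimension, over an arbitrary field $\mathbb K$, that is, a $\mathbb K$-vector space with a bilinear product $[\,,\,]$ such that $[[a,b],c]=[a,[b,c]]+[[a,c],b]$ for all $a,b,c\in L$. Suppose that the automorphism group of $L$ contains a finite Frobenius group $FH$ with cyclic kernel $F$ and complement $H$ of order $q$ (so $F$ and $H$ are finite nontrivial subgroups, $H$ normalizes $F$, $F\cap H=1$, and $C_H(f)=1$ for every $1\neq f\in F$). Suppose that the fixed-point subalgebra $C_L(F)=\{x\in L: x^{\varphi}=x \text{ for all }\varphi\in F\}$ is $0$ and that the fixed-point subalgebra $C_L(H)$ is nilpotent of class at most $c$. Then $L$ is nilpotent of class at most $f(q,c)$. Here an algebra $A$ is nilpotent of class at most $k$ if $\gamma_{k+1}(A)=0$, where $\gamma_1(A)=A$ and $\gamma_{i+1}(A)=[\gamma_i(A),A]$ is the linear span of all products $[x,y]$ with $x\in\gamma_i(A)$, $y\in A$. -/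

import Mathlib

/-! A (nonassociative) algebra `L` over a field `K` is given by
`[NonUnitalNonAssocRing L] [Module K L] [IsScalarTower K L L] [SMulCommClass K L L]`;
the product `[a, b]` of the algebra is written `a * b`. -/

/-- `L` is a (right) Leibniz algebra: `[[a, b], c] = [a, [b, c]] + [[a, c], b]`. -/
def IsRightLeibniz (L : Type*) [NonUnitalNonAssocRing L] : Prop :=
  ∀ a b c : L, (a * b) * c = a * (b * c) + (a * c) * b

/-- The group of automorphisms of the `K`-algebra `L`: the bijective `K`-linear maps that
preserve the product. -/
def algebraAut (K L : Type*) [Field K] [NonUnitalNonAssocRing L] [Module K L] :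
    Subgroup (L ≃ₗ[K] L) where
  carrier := {φ | ∀ a b : L, φ (a * b) = φ a * φ b}
  one_mem' := fun _ _ => rfl
  mul_mem' := by
    intro φ ψ hφ hψ a b
    simp only [Set.mem_setOf_eq] at hφ hψ
    simp only [LinearEquiv.mul_apply, hψ, hφ]
  inv_mem' := by
    intro φ hφ a b
    simp only [Set.mem_setOf_eq] at hφ
    apply φ.injective
    have key : ∀ x : L, φ (φ⁻¹ x) = x := fun x => φ.apply_symm_apply x
    rw [hφ, key, key, key]

/-- The fixed-point subalgebra `C_L(G)` of a group `G` of automorphisms of `L`. -/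
def fixedPointSubalgebra {K L : Type*} [Field K] [NonUnitalNonAssocRing L] [Module K L]
    (G : Subgroup (algebraAut K L)) : NonUnitalSubalgebra K L where
  carrier := {x | ∀ φ ∈ G, (φ : L ≃ₗ[K] L) x = x}
  zero_mem' := fun φ _ => map_zero (φ : L ≃ₗ[K] L)
  add_mem' := by
    intro x y hx hy φ hφ
    rw [map_add, hx φ hφ, hy φ hφ]
  mul_mem' := by
    intro x y hx hy φ hφ
    rw [φ.2 x y, hx φ hφ, hy φ hφ]
  smul_mem' := by
    intro k x hx φ hφ
    rw [map_smul, hx φ hφ]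

/-- The lower central series, indexed from `0`: `algebraLCS K L k` is `γ_{k+1}(L)`, where
`γ_1(L) = L` and `γ_{k+1}(L) = [γ_k(L), L]` is the span of the products `[x, y]` with
`x ∈ γ_k(L)` and `y ∈ L`. -/
def algebraLCS (K L : Type*) [Field K] [NonUnitalNonAssocRing L] [Module K L] :
    ℕ → Submodule K L
  | 0 => ⊤
  | k + 1 => Submodule.span K {z | ∃ x ∈ algebraLCS K L k, ∃ y : L, z = x * y}

/-- `L` is nilpotent of class at most `c`, that is, `γ_{c+1}(L) = 0`. -/
def IsNilpotentOfClassLE (K L : Type*) [Field K] [NonUnitalNonAssocRing L] [Module K L]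
    (c : ℕ) : Prop :=
  algebraLCS K L c = ⊥

/-- The subgroups `F` and `H` of `A` are the kernel and the complement of a (finite) Frobenius
group `FH`: both are finite and nontrivial, `H` normalizes `F`, `F ∩ H = 1`, and
`C_H(f) = 1` for every `f ≠ 1` in `F`. -/
structure IsFrobeniusPair {A : Type*} [Group A] (F H : Subgroup A) : Prop where
  finite_kernel : Finite F
  finite_complement : Finite H
  kernel_ne_bot : F ≠ ⊥
  complement_ne_bot : H ≠ ⊥
  complement_le_normalizer : H ≤ Subgroup.normalizer (F : Set A)
  disjoint : Disjoint F H
  fixedPointFree : ∀ f ∈ F, f ≠ 1 → ∀ h ∈ H, h * f = f * h → h = 1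

/-! In a right Leibniz algebra the right multiplications satisfy `R_[x,y] = [R_y, R_x]`. They
therefore form a Lie algebra of operators on `L`, and `L` is nilpotent as soon as all sufficiently
long products of these operators vanish.

Let `φ` generate `F`. The part of its order divisible by the characteristic can be discarded, and
over the algebraic closure `L` is the sum of the eigenspaces of `φ`. So `L` and its operators are
graded by `ZMod n` with trivial component of degree 0, and `h ∈ H` multiplies degrees by `χ h`; the
Frobenius condition makes `χ h - 1` a unit for `h ≠ 1`. Nilpotency of `C_L(H)` enters only through
traces over `H`: a product of `c` traces of operators kills every trace in `L`. Call degrees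
independent if no nontrivial twist of them by values of `χ` preserves their sum. When the degrees of
the operators and of the vector are independent, the untwisted product is the only term of its
degree in the expanded identity, so it vanishes (`IsFrobeniusAction.isSelective`). Only boundedly
many degrees destroy independence when adjoined to an independent family.

Solvability (`iterate_derivedFamily_apply_mem`) goes by induction on the length of independent
words. The image of an independent word of maximal relevant length is killed by all but boundedly
many degrees, so the module it generates has boundedly many components, and Kreknin's theorem, with
a bound depending only on the number of nontrivial components, applies.

Nilpotency then follows one derived step at a time, as in P. Hall's criterion. On a section where
the operators commute, a long word contains `c` letters independent with the vector, or many letters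
of one degree `b`. In the latter case either `b` has large order, or the letters lead to degree 0,
or a Vandermonde argument with twisted traces applies
(`IsFrobeniusAction.wordOp_mem_of_isAbelianSection`). -/

/-! ### Kreknin's theorem with few nontrivial components. -/

section Kreknin

variable {K M : Type*} [CommRing K] [LieRing M] [LieAlgebra K M]

/-- The derived family of a family of submodules of a Lie algebra indexed by degrees. -/
def derivedFamily {A : Type*} [Add A] (g : A → Submodule K M) (e : A) : Submodule K M :=
  Submodule.span K {z | ∃ u w, u + w = e ∧ ∃ x ∈ g u, ∃ y ∈ g w, z = ⁅x, y⁆}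

/-- The family `g` is compatible with the bracket and the addition of degrees. -/
def IsLieGraded {A : Type*} [Add A] (g : A → Submodule K M) : Prop :=
  ∀ a b, ∀ x ∈ g a, ∀ y ∈ g b, ⁅x, y⁆ ∈ g (a + b)

theorem derivedFamily_le {A : Type*} [Add A] {g : A → Submodule K M} (hg : IsLieGraded g) (e : A) :
    derivedFamily g e ≤ g e := by
  refine Submodule.span_le.2 ?_
  rintro z ⟨u, w, rfl, x, hx, y, hy, rfl⟩
  exact hg u w x hx y hy

theorem lie_mem_derivedFamily {A : Type*} [Add A] {g : A → Submodule K M} {a b : A} {x y : M}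
    (hx : x ∈ g a) (hy : y ∈ g b) : ⁅x, y⁆ ∈ derivedFamily g (a + b) :=
  Submodule.subset_span ⟨a, b, rfl, x, hx, y, hy, rfl⟩

theorem derivedFamily_isLieGraded {A : Type*} [Add A] {g : A → Submodule K M}
    (hg : IsLieGraded g) : IsLieGraded (derivedFamily g) :=
  fun _ _ _ hx _ hy => lie_mem_derivedFamily (derivedFamily_le hg _ hx) (derivedFamily_le hg _ hy)

theorem iterate_derivedFamily_isLieGraded {A : Type*} [Add A] {g : A → Submodule K M}
    (hg : IsLieGraded g) (k : ℕ) : IsLieGraded (derivedFamily^[k] g) := by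
  induction k with
  | zero => exact hg
  | succ k ih => rw [Function.iterate_succ_apply']; exact derivedFamily_isLieGraded ih

theorem iterate_derivedFamily_le {A : Type*} [Add A] {g : A → Submodule K M} (hg : IsLieGraded g)
    {k l : ℕ} (hkl : k ≤ l) (e : A) : derivedFamily^[l] g e ≤ derivedFamily^[k] g e := by
  induction l, hkl using Nat.le_induction with
  | base => exact le_rfl
  | succ l _ ih =>
    rw [Function.iterate_succ_apply']
    exact (derivedFamily_le (iterate_derivedFamily_isLieGraded hg l) e).trans ih

theorem lie_lie_eq_sub (x y z : M) : ⁅x, ⁅y, z⁆⁆ = ⁅⁅x, y⁆, z⁆ - ⁅⁅x, z⁆, y⁆ := by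
  rw [leibniz_lie, ← lie_skew y ⁅x, z⁆, ← sub_eq_add_neg]

/-- The graded subalgebra generated by `Z` and the components of `g` with degrees in `P`. -/
inductive GradedClosure {A : Type*} [Add A] (g : A → Submodule K M) (Z : Submodule K M)
    (P : A → Prop) : A → M → Prop
  | base {a : A} {z : M} : z ∈ Z → GradedClosure g Z P a z
  | gen {i : A} {x : M} : P i → x ∈ g i → GradedClosure g Z P i x
  | add {a : A} {x y : M} : GradedClosure g Z P a x → GradedClosure g Z P a y →
      GradedClosure g Z P a (x + y)
  | smul {a : A} {x : M} (t : K) : GradedClosure g Z P a x → GradedClosure g Z P a (t • x)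
  | lie {a i : A} {y x : M} : GradedClosure g Z P a y → P i → x ∈ g i →
      GradedClosure g Z P (a + i) ⁅y, x⁆

namespace GradedClosure

variable {A : Type*} [AddCommGroup A] {g : A → Submodule K M} {Z : Submodule K M} {P : A → Prop}

theorem mem_sup (hg : IsLieGraded g) (hZ : ∀ i, ∀ x ∈ g i, ∀ z ∈ Z, ⁅x, z⁆ ∈ Z) {a : A} {y : M}
    (hy : GradedClosure g Z P a y) : y ∈ g a ⊔ Z := by
  induction hy with
  | base h => exact Submodule.mem_sup_right h
  | gen _ h => exact Submodule.mem_sup_left h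
  | add _ _ h h' => exact add_mem h h'
  | smul t _ h => exact Submodule.smul_mem _ t h
  | lie _ _ hx h =>
    obtain ⟨y, hy, z, hz, rfl⟩ := Submodule.mem_sup.1 h
    rw [add_lie]
    refine add_mem (Submodule.mem_sup_left (hg _ _ _ hy _ hx)) (Submodule.mem_sup_right ?_)
    rw [← lie_skew]
    exact neg_mem (hZ _ _ hx _ hz)

theorem lie_mem_base (hg : IsLieGraded g) (hZ : ∀ i, ∀ x ∈ g i, ∀ z ∈ Z, ⁅x, z⁆ ∈ Z)
    (hZZ : ∀ x ∈ Z, ∀ z ∈ Z, ⁅x, z⁆ ∈ Z) {a : A}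
    {y z : M} (hy : GradedClosure g Z P a y) (hz : z ∈ Z) : ⁅y, z⁆ ∈ Z := by
  obtain ⟨y', hy', w, hw, rfl⟩ := Submodule.mem_sup.1 (hy.mem_sup hg hZ)
  rw [add_lie]
  exact add_mem (hZ _ _ hy' _ hz) (hZZ _ hw _ hz)

/-- The inductive definition only brackets with a generator on the right; the Jacobi identity
reduces brackets with longer elements to this case. -/
theorem lie_closed (hg : IsLieGraded g) (hZ : ∀ i, ∀ x ∈ g i, ∀ z ∈ Z, ⁅x, z⁆ ∈ Z)
    (hZZ : ∀ x ∈ Z, ∀ z ∈ Z, ⁅x, z⁆ ∈ Z) {a b : A} {y z : M}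
    (hy : GradedClosure g Z P a y) (hz : GradedClosure g Z P b z) :
    GradedClosure g Z P (a + b) ⁅y, z⁆ := by
  induction hz generalizing a y with
  | base h => exact .base (hy.lie_mem_base hg hZ hZZ h)
  | gen hP h => exact .lie hy hP h
  | add _ _ h h' => rw [lie_add]; exact .add (h hy) (h' hy)
  | smul t _ h => rw [lie_smul]; exact .smul t (h hy)
  | @lie b i _ _ _ hP hx h =>
    rw [lie_lie_eq_sub, sub_eq_add_neg, ← neg_one_smul K]
    refine .add ?_ (.smul _ ?_)
    · rw [← add_assoc]; exact .lie (h hy) hP hx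
    · have := h (hy.lie hP hx)
      rwa [add_assoc, add_comm i b] at this

/-- The Jacobi identity moves the letters of `y` onto `x` one by one until a single generator is
left in last place. The accumulated left factor is just some homogeneous element. -/
theorem lie_mem_span (hg : IsLieGraded g) (hZ : ∀ i, ∀ x ∈ g i, ∀ z ∈ Z, ⁅x, z⁆ ∈ Z) {a b : A}
    {x y : M} (hx : x ∈ g a) (hy : GradedClosure g Z P b y) :
    ⁅x, y⁆ ∈ Z ⊔ Submodule.span K
      {t | ∃ w i, w + i = a + b ∧ P i ∧ ∃ x ∈ g w, ∃ z ∈ g i, t = ⁅x, z⁆} := by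
  induction hy generalizing a x with
  | base h => exact Submodule.mem_sup_left (hZ _ _ hx _ h)
  | gen hP h =>
    exact Submodule.mem_sup_right (Submodule.subset_span ⟨_, _, rfl, hP, _, hx, _, h, rfl⟩)
  | add _ _ h h' => rw [lie_add]; exact add_mem (h hx) (h' hx)
  | smul t _ h => rw [lie_smul]; exact Submodule.smul_mem _ _ (h hx)
  | @lie b i y z hy hP hz h =>
    rw [lie_lie_eq_sub]
    refine sub_mem ?_ ?_
    · obtain ⟨y', hy', w, hw, rfl⟩ := Submodule.mem_sup.1 (hy.mem_sup hg hZ)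
      rw [lie_add, add_lie]
      refine add_mem (Submodule.mem_sup_right (Submodule.subset_span
        ⟨a + b, i, by abel, hP, _, hg _ _ _ hx _ hy', _, hz, rfl⟩)) (Submodule.mem_sup_left ?_)
      rw [← lie_skew]
      exact neg_mem (hZ _ _ hz _ (hZ _ _ hx _ hw))
    · have := h (hg _ _ _ hx _ hz)
      rwa [show a + (b + i) = a + i + b by abel]

end GradedClosure

/-- Kreknin's theorem for a family graded by `ZMod n` with trivial zero component and at most
`#Δ` components outside `Z`. -/
theorem iterate_derivedFamily_le_of_support {n : ℕ} [NeZero n] {Z : Submodule K M}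
    (hZZ : ∀ x ∈ Z, ∀ z ∈ Z, ⁅x, z⁆ ∈ Z) (Δ : Finset (ZMod n)) (t : ℕ)
    {g : ZMod n → Submodule K M} (hg : IsLieGraded g)
    (hZ : ∀ i, ∀ x ∈ g i, ∀ z ∈ Z, ⁅x, z⁆ ∈ Z)
    (h0 : g 0 ≤ Z) (hΔ : ∀ i ∉ Δ, g i ≤ Z) (e : ZMod n) (x : M)
    (hx : x ∈ derivedFamily^[2 ^ (Δ.filter (fun i => i.val < t)).card - 1] g e) :
    GradedClosure g Z (fun i => i ∈ Δ ∧ t ≤ i.val) e x := by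
  induction t generalizing g e x with
  | zero =>
    simp only [not_lt_zero, Finset.filter_false, Finset.card_empty, pow_zero, Nat.sub_self] at hx
    by_cases he : e ∈ Δ
    · exact .gen ⟨he, Nat.zero_le _⟩ hx
    · exact .base (hΔ e he hx)
  | succ t ih =>
    set f := 2 ^ (Δ.filter (fun i => i.val < t)).card - 1 with hf
    by_cases hex : ∃ e₀ ∈ Δ, e₀.val = t
    · obtain ⟨e₀, he₀, rfl⟩ := hex
      have hcard : (Δ.filter (fun i => i.val < e₀.val + 1)).card
          = (Δ.filter (fun i => i.val < e₀.val)).card + 1 := by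
        have : Δ.filter (fun i => i.val < e₀.val + 1)
            = insert e₀ (Δ.filter (fun i => i.val < e₀.val)) := by
          ext i
          simp only [Finset.mem_filter, Finset.mem_insert, Nat.lt_succ_iff_lt_or_eq]
          constructor
          · rintro ⟨h1, h2 | h2⟩
            · exact Or.inr ⟨h1, h2⟩
            · exact Or.inl (ZMod.val_injective n h2)
          · rintro (rfl | ⟨h1, h2⟩)
            · exact ⟨he₀, Or.inr rfl⟩
            · exact ⟨h1, Or.inl h2⟩
        rw [this, Finset.card_insert_of_notMem (by simp)]
      -- One more degree in `Δ` costs `f + 1` derivations to eliminate the component `e₀`, and then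
      -- `f` more to apply the induction hypothesis to the resulting family.
      have hexp : 2 ^ (Δ.filter (fun i => i.val < e₀.val + 1)).card - 1 = f + (f + 1) := by
        have := Nat.one_le_two_pow (n := (Δ.filter (fun i => i.val < e₀.val)).card)
        rw [hcard, pow_succ]; omega
      have key : ∀ y ∈ derivedFamily^[f + 1] g e₀,
          GradedClosure g Z (fun i => i ∈ Δ ∧ e₀.val + 1 ≤ i.val) e₀ y := by
        intro y hy
        rw [Function.iterate_succ_apply'] at hy
        induction hy using Submodule.span_induction with
        | zero => exact .base (zero_mem _)
        | add _ _ _ _ h h' => exact .add h h'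
        | smul t _ _ h => exact .smul t h
        | mem z hz =>
          obtain ⟨u, w, huw, x, hx, y, hy, rfl⟩ := hz
          have hy' := ih hg hZ h0 hΔ w y hy
          have hx' := iterate_derivedFamily_le hg (Nat.zero_le _) u hx
          have hxy := GradedClosure.lie_mem_span hg hZ hx' hy'
          obtain ⟨z, hz, s, hs, hzs⟩ := Submodule.mem_sup.1 hxy
          rw [← hzs]
          refine .add (.base hz) ?_
          clear hzs
          induction hs using Submodule.span_induction with
          | zero => exact .base (zero_mem _)
          | add _ _ _ _ h h' => exact .add h h'
          | smul t _ _ h => exact .smul t h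
          | mem s hs =>
            obtain ⟨w', i, hwi, ⟨hiΔ, hi⟩, x, hx, z, hz, rfl⟩ := hs
            rw [huw] at hwi
            rcases hi.eq_or_lt with hi | hi
            · have : i = e₀ := (ZMod.val_injective n hi).symm
              have hw' : w' = 0 := by rw [this] at hwi; simpa using hwi
              subst hw'
              refine .base ?_
              rw [← lie_skew]
              exact neg_mem (hZ _ _ hz _ (h0 hx))
            · by_cases hw' : w' ∈ Δ
              · have hlt : e₀.val < w'.val := by
                  have h1 := ZMod.val_add w' i
                  rw [hwi] at h1
                  have h2 := ZMod.val_lt i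
                  have h3 := ZMod.val_lt w'
                  by_contra hcon
                  rcases lt_or_ge (w'.val + i.val) n with h4 | h4
                  · rw [Nat.mod_eq_of_lt h4] at h1; omega
                  · rw [Nat.mod_eq_sub_mod h4, Nat.mod_eq_of_lt (by omega)] at h1; omega
                have := GradedClosure.lie (Z := Z) (P := fun i => i ∈ Δ ∧ e₀.val + 1 ≤ i.val)
                  (.gen ⟨hw', hlt⟩ hx) ⟨hiΔ, hi⟩ hz
                rwa [hwi] at this
              · refine .base ?_
                rw [← lie_skew]
                exact neg_mem (hZ _ _ hz _ (hΔ _ hw' hx))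
      have hle : ∀ i, derivedFamily^[f + 1] g i ≤ g i := fun i =>
        iterate_derivedFamily_le hg (Nat.zero_le _) i
      rw [hexp, Function.iterate_add_apply] at hx
      have := ih (iterate_derivedFamily_isLieGraded hg (f + 1)) (fun i x hx => hZ i x (hle i hx))
        ((hle 0).trans h0) (fun i hi => (hle i).trans (hΔ i hi)) e x hx
      have gen : ∀ i x, i ∈ Δ ∧ e₀.val ≤ i.val → x ∈ derivedFamily^[f + 1] g i →
          GradedClosure g Z (fun i => i ∈ Δ ∧ e₀.val + 1 ≤ i.val) i x := by
        rintro i x ⟨hi, hle'⟩ hx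
        rcases hle'.eq_or_lt with h | h
        · obtain rfl := ZMod.val_injective n h
          exact key x hx
        · exact .gen ⟨hi, h⟩ (hle i hx)
      clear hx
      induction this with
      | base h => exact .base h
      | gen hP h => exact gen _ _ hP h
      | add _ _ h h' => exact .add h h'
      | smul t _ h => exact .smul t h
      | lie _ hP hx h => exact h.lie_closed hg hZ hZZ (gen _ _ hP hx)
    · have hfil : Δ.filter (fun i => i.val < t + 1) = Δ.filter (fun i => i.val < t) := by
        refine Finset.filter_congr fun i hi => ?_
        have : i.val ≠ t := fun h => hex ⟨i, hi, h⟩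
        omega
      rw [hfil] at hx
      have := ih hg hZ h0 hΔ e x hx
      have hP : (fun i : ZMod n => i ∈ Δ ∧ t + 1 ≤ i.val) = fun i => i ∈ Δ ∧ t ≤ i.val := by
        ext i
        refine and_congr_right fun hi => ?_
        have : i.val ≠ t := fun h => hex ⟨i, hi, h⟩
        omega
      rwa [hP]

/-- At threshold `n` no residue is left to serve as a generator, so the closure is `Z` itself. -/
theorem iterate_derivedFamily_le_of_card_le {n : ℕ} [NeZero n] {Z : Submodule K M}
    (hZZ : ∀ x ∈ Z, ∀ z ∈ Z, ⁅x, z⁆ ∈ Z) (Δ : Finset (ZMod n)) {g : ZMod n → Submodule K M}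
    (hg : IsLieGraded g) (hZ : ∀ i, ∀ x ∈ g i, ∀ z ∈ Z, ⁅x, z⁆ ∈ Z)
    (h0 : g 0 ≤ Z) (hΔ : ∀ i ∉ Δ, g i ≤ Z) {d : ℕ} (hd : Δ.card ≤ d) (e : ZMod n) :
    derivedFamily^[2 ^ d] g e ≤ Z := by
  intro x hx
  have hfil : Δ.filter (fun i => i.val < n) = Δ :=
    Finset.filter_true_of_mem fun i _ => ZMod.val_lt i
  have hle : 2 ^ Δ.card - 1 ≤ 2 ^ d :=
    (Nat.sub_le _ _).trans (Nat.pow_le_pow_right (by norm_num) hd)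
  have := iterate_derivedFamily_le_of_support hZZ Δ n hg hZ h0 hΔ e x
    (by rw [hfil]; exact iterate_derivedFamily_le hg hle e hx)
  clear hx
  induction this with
  | base h => exact h
  | gen hP _ => exact absurd hP.2 (by have := ZMod.val_lt ‹ZMod n›; omega)
  | add _ _ h h' => exact add_mem h h'
  | smul t _ h => exact Submodule.smul_mem _ t h
  | @lie _ i _ _ _ hP => exact absurd hP.2 (by have := ZMod.val_lt i; omega)

end Kreknin

/-! ### Independent families of degrees. -/

section Independence

variable {n : ℕ} {H : Type*} [Group H]

/-- A multiset of degrees is independent with respect to the character `χ` if its sum is not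
changed by twisting its members by values of `χ` only when the twist is trivial. -/
def IndependentDegrees (χ : H →* ZMod n) (m : Multiset (ZMod n)) : Prop :=
  ∀ T : Multiset (H × ZMod n), T.map Prod.snd = m →
    (T.map fun p => χ p.1 * p.2).sum = m.sum → ∀ p ∈ T, p.1 = 1

variable {χ : H →* ZMod n}

theorem independentDegrees_singleton (hχ : ∀ h, h ≠ 1 → IsUnit (χ h - 1)) {a : ZMod n}
    (ha : a ≠ 0) : IndependentDegrees χ {a} := by
  intro T hT hsum p hp
  obtain ⟨p', rfl, hp'⟩ := Multiset.map_eq_singleton.1 hT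
  rw [Multiset.mem_singleton] at hp
  subst hp
  by_contra hne
  simp only [Multiset.map_singleton, Multiset.sum_singleton, hp'] at hsum
  exact ha ((hχ _ hne).mul_right_eq_zero.1 (by rw [sub_mul, hsum, one_mul, sub_self]))

theorem exists_finset_twisted_sums [Fintype H] (χ : H →* ZMod n) (m : Multiset (ZMod n)) :
    ∃ S : Finset (ZMod n), S.card ≤ Fintype.card H ^ Multiset.card m ∧
      ∀ T : Multiset (H × ZMod n), T.map Prod.snd = m →
        (T.map fun p => χ p.1 * p.2).sum ∈ S := by
  classical
  induction m using Multiset.induction_on with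
  | empty =>
    refine ⟨{0}, by simp, fun T hT => ?_⟩
    rw [Multiset.map_eq_zero.1 hT]; simp
  | cons j m ih =>
    obtain ⟨S, hS, hST⟩ := ih
    refine ⟨(Finset.univ ×ˢ S).image fun p : H × ZMod n => χ p.1 * j + p.2, ?_, fun T hT => ?_⟩
    · refine Finset.card_image_le.trans ?_
      rw [Finset.card_product, Finset.card_univ, Multiset.card_cons, pow_succ']
      exact Nat.mul_le_mul_left _ hS
    · obtain ⟨⟨h, j'⟩, hpT, rfl, hT'⟩ := (Multiset.map_eq_cons _ _ _ _).2 hT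
      rw [← Multiset.cons_erase hpT, Multiset.map_cons, Multiset.sum_cons]
      exact Finset.mem_image.2 ⟨(h, _), Finset.mem_product.2 ⟨Finset.mem_univ _, hST _ hT'⟩, rfl⟩

/-- A nontrivial twist preserving the sum must twist `j` by some `h ≠ 1`, because `m` is
independent. Then `(χ h - 1) j = m.sum - s` for a twisted sum `s` of `m`, which determines `j` from
`h` and `s`. -/
theorem exists_finset_not_independentDegrees_cons [Fintype H]
    (hχ : ∀ h, h ≠ 1 → IsUnit (χ h - 1)) {m : Multiset (ZMod n)} (hm : IndependentDegrees χ m) :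
    ∃ D : Finset (ZMod n), D.card ≤ Fintype.card H ^ (Multiset.card m + 1) ∧
      ∀ j ∉ D, IndependentDegrees χ (j ::ₘ m) := by
  classical
  obtain ⟨S, hS, hST⟩ := exists_finset_twisted_sums χ m
  refine ⟨(Finset.univ ×ˢ S).image fun p : H × ZMod n => Ring.inverse (χ p.1 - 1) * (m.sum - p.2),
    ?_, fun j hj T hT hsum => ?_⟩
  · refine Finset.card_image_le.trans ?_
    rw [Finset.card_product, Finset.card_univ, pow_succ']
    exact Nat.mul_le_mul_left _ hS
  · obtain ⟨⟨h, j'⟩, hpT, rfl, hT'⟩ := (Multiset.map_eq_cons _ _ _ _).2 hT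
    have hs := hST _ hT'
    rw [← Multiset.cons_erase hpT, Multiset.map_cons, Multiset.sum_cons, Multiset.sum_cons] at hsum
    set s := ((T.erase (h, j')).map fun p => χ p.1 * p.2).sum
    have h1 : h = 1 := by
      by_contra hne
      refine hj (Finset.mem_image.2 ⟨(h, s), Finset.mem_product.2 ⟨Finset.mem_univ _, hs⟩, ?_⟩)
      have : m.sum - s = (χ h - 1) * j' := by
        simp only at hsum
        linear_combination -hsum
      simp only [this]
      rw [← mul_assoc, Ring.inverse_mul_cancel _ (hχ h hne), one_mul]
    subst h1
    have hs' : s = m.sum := by simpa using hsum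
    intro p hp
    rw [← Multiset.cons_erase hpT, Multiset.mem_cons] at hp
    rcases hp with rfl | hp
    · rfl
    · exact hm _ hT' hs' p hp

/-- The entrywise bound used to bound the order of an element some multiple of which is a
nontrivial sum of twists. -/
def twistOrderBound (q s : ℕ) : ℕ := q.factorial * (q * (2 * s) ^ 2 + q * q ^ 2) ^ q

/-- The function `y ↦ χ y * b` is killed by integer matrices `α` and `β` that have no common kernel
over `ℤ`. Hence `det (αᵀα + βᵀβ)` is a nonzero integer annihilating `b`, and its size is bounded
through the entries. Using `α` alone would fail, since it kills constants. -/
theorem addOrderOf_le_of_twisted_sum [Fintype H] (hχ : ∀ h, h ≠ 1 → IsUnit (χ h - 1))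
    {b : ZMod n} (l : List H) (hl : ∃ h ∈ l, h ≠ 1)
    (hsum : (l.map fun h => χ h * b).sum = l.length * b) :
    addOrderOf b ≤ twistOrderBound (Fintype.card H) l.length := by
  classical
  obtain ⟨h₁, hh₁, hne⟩ := hl
  -- the operators `∑ (1 - h)` and `∑ h₁ ^ j` on functions on `H`
  let α : Matrix H H ℤ := fun x y =>
    (l.map fun h => (if x = y then 1 else 0) - (if x * h = y then 1 else 0)).sum
  let β : Matrix H H ℤ := fun x y =>
    ∑ j ∈ Finset.range (orderOf h₁), if x * h₁ ^ j = y then 1 else 0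
  have hα : ∀ {R : Type} [Ring R] (f : H → R) (x : H),
      ∑ y, (α x y : R) * f y = (l.map fun h => f x - f (x * h)).sum := by
    intro R _ f x
    simp only [α]
    clear hh₁ hsum
    induction l with
    | nil => simp
    | cons h l ih =>
      simp only [List.map_cons, List.sum_cons, Int.cast_add, add_mul, Finset.sum_add_distrib, ih]
      simp [sub_mul, ite_mul]
  have hβ : ∀ {R : Type} [Ring R] (f : H → R) (x : H),
      ∑ y, (β x y : R) * f y = ∑ j ∈ Finset.range (orderOf h₁), f (x * h₁ ^ j) := by
    intro R _ f x
    simp only [β, Int.cast_sum, Finset.sum_mul]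
    rw [Finset.sum_comm]
    simp [ite_mul]
  let M : Matrix H H ℤ := α.transpose * α + β.transpose * β
  have hdet : M.det ≠ 0 := by
    intro h0
    obtain ⟨v, hv, hMv⟩ := Matrix.exists_mulVec_eq_zero_iff.2 h0
    have hsq : α.mulVec v ⬝ᵥ α.mulVec v + β.mulVec v ⬝ᵥ β.mulVec v = 0 := by
      have := congrArg (fun w => v ⬝ᵥ w) hMv
      simpa [M, Matrix.add_mulVec, ← Matrix.mulVec_mulVec, Matrix.dotProduct_mulVec,
        Matrix.vecMul_transpose] using this
    have hnn : ∀ w : H → ℤ, 0 ≤ w ⬝ᵥ w := fun w =>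
      Finset.sum_nonneg fun i _ => mul_self_nonneg _
    have hαv : α.mulVec v = 0 := dotProduct_self_eq_zero.1 (by
      have := hnn (α.mulVec v); have := hnn (β.mulVec v); omega)
    have hβv : β.mulVec v = 0 := dotProduct_self_eq_zero.1 (by
      have := hnn (α.mulVec v); have := hnn (β.mulVec v); omega)
    have hαv' : ∀ x, (l.map fun h => v x - v (x * h)).sum = 0 := fun x => by
      rw [← hα v x]; simpa [Matrix.mulVec, dotProduct] using congrFun hαv x
    have hβv' : ∀ x, ∑ j ∈ Finset.range (orderOf h₁), v (x * h₁ ^ j) = 0 := fun x => by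
      rw [← hβ v x]; simpa [Matrix.mulVec, dotProduct] using congrFun hβv x
    -- Translation preserves `∑ v²`, so `∑ (v x - v (x h))² = ∑ 2 v x (v x - v (x h))`. Summed over
    -- `l` the right side pairs `2v` with `α v = 0`, so every square vanishes.
    have hfix : ∀ h ∈ l, ∀ x, v (x * h) = v x := by
      have key : (l.map fun h => ∑ x, (v x - v (x * h)) ^ 2).sum = 0 := by
        have h1 : ∀ h, ∑ x, (v x - v (x * h)) ^ 2 = ∑ x, 2 * v x * (v x - v (x * h)) := by
          intro h
          have h2 : ∑ x, v (x * h) ^ 2 = ∑ x, v x ^ 2 :=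
            Fintype.sum_equiv (Equiv.mulRight h) _ _ fun _ => rfl
          have h3 : ∑ x, ((v x - v (x * h)) ^ 2 - 2 * v x * (v x - v (x * h)))
              = ∑ x, v (x * h) ^ 2 - ∑ x, v x ^ 2 := by
            rw [← Finset.sum_sub_distrib]
            exact Finset.sum_congr rfl fun x _ => by ring
          rw [h2, sub_self, Finset.sum_sub_distrib] at h3
          linarith
        simp only [h1]
        have h4 : ∀ l : List H, (l.map fun h => ∑ x, 2 * v x * (v x - v (x * h))).sum
            = ∑ x, 2 * v x * (l.map fun h => v x - v (x * h)).sum := by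
          intro l
          induction l with
          | nil => simp
          | cons h l ih => simp [ih, mul_add, Finset.sum_add_distrib]
        rw [h4]
        simp [hαv']
      intro h hh x
      have h5 : ∑ x, (v x - v (x * h)) ^ 2 = 0 := by
        refine le_antisymm ?_ (Finset.sum_nonneg fun i _ => sq_nonneg _)
        rw [← key]
        exact List.single_le_sum (by
          intro y hy
          obtain ⟨h, -, rfl⟩ := List.mem_map.1 hy
          exact Finset.sum_nonneg fun i _ => sq_nonneg _) _ (List.mem_map.2 ⟨h, hh, rfl⟩)
      have := (Finset.sum_eq_zero_iff_of_nonneg fun i _ => sq_nonneg _).1 h5 x (Finset.mem_univ _)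
      have := pow_eq_zero_iff (two_ne_zero) |>.1 this
      linarith
    refine hv (funext fun x => ?_)
    have hpow : ∀ j, v (x * h₁ ^ j) = v x := by
      intro j
      induction j with
      | zero => simp
      | succ j ih => rw [pow_succ, ← mul_assoc, hfix h₁ hh₁, ih]
    have := hβv' x
    simp only [hpow, Finset.sum_const, Finset.card_range, nsmul_eq_mul] at this
    rcases mul_eq_zero.1 this with h | h
    · have := orderOf_pos h₁; omega
    · exact h
  -- `χ h₁ - 1` is a unit and its product with the geometric sum is `χ h₁ ^ orderOf h₁ - 1 = 0`.
  have hgeom : ∑ j ∈ Finset.range (orderOf h₁), χ h₁ ^ j = 0 := by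
    refine (hχ h₁ hne).mul_right_eq_zero.1 ?_
    rw [mul_geom_sum, ← map_pow, pow_orderOf_eq_one, map_one, sub_self]
  let w : H → ZMod n := fun y => χ y * b
  have hαw : (α.map (Int.cast : ℤ → ZMod n)).mulVec w = 0 := by
    funext x
    have h1 : ∀ l : List H, (l.map fun h => w x - w (x * h)).sum
        = χ x * (l.length * b - (l.map fun h => χ h * b).sum) := by
      intro l
      simp only [w]
      induction l with
      | nil => simp
      | cons h l ih =>
        rw [List.map_cons, List.sum_cons, ih]
        simp only [map_mul, List.length_cons, List.map_cons, List.sum_cons]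
        push_cast
        ring
    have := hα w x
    rw [h1, hsum, sub_self, mul_zero] at this
    simpa [Matrix.mulVec, dotProduct] using this
  have hβw : (β.map (Int.cast : ℤ → ZMod n)).mulVec w = 0 := by
    funext x
    have := hβ w x
    simp only [w, map_mul, map_pow] at this
    rw [← Finset.sum_mul, ← Finset.mul_sum, hgeom, mul_zero, zero_mul] at this
    simpa [Matrix.mulVec, dotProduct] using this
  have hMw : (M.map (Int.castRingHom (ZMod n))).mulVec w = 0 := by
    have : M.map (Int.castRingHom (ZMod n))
        = (α.transpose.map (Int.castRingHom (ZMod n))) * (α.map (Int.cast : ℤ → ZMod n))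
          + (β.transpose.map (Int.castRingHom (ZMod n))) * (β.map (Int.cast : ℤ → ZMod n)) := by
      rw [← RingHom.mapMatrix_apply]
      simp only [M, map_add, map_mul]
      rfl
    rw [this, Matrix.add_mulVec, ← Matrix.mulVec_mulVec, ← Matrix.mulVec_mulVec, hαw, hβw]
    simp
  have hdw : (M.det : ZMod n) * b = 0 := by
    have := congrArg (fun u => (M.map (Int.castRingHom (ZMod n))).adjugate.mulVec u) hMw
    simp only [Matrix.mulVec_mulVec, Matrix.adjugate_mul, Matrix.mulVec_zero] at this
    have := congrFun this 1
    rw [Matrix.smul_mulVec, Matrix.one_mulVec, ← RingHom.mapMatrix_apply,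
      ← RingHom.map_det] at this
    simpa [w] using this
  have hdvd : addOrderOf b ∣ M.det.natAbs := by
    have h1 : (addOrderOf b : ℤ) ∣ M.det := by
      rw [addOrderOf_dvd_iff_zsmul_eq_zero, zsmul_eq_mul]
      exact hdw
    exact Int.natCast_dvd.1 h1
  refine (Nat.le_of_dvd (Int.natAbs_pos.2 hdet) hdvd).trans ?_
  have hαb : ∀ x y, |α x y| ≤ 2 * l.length := by
    intro x y
    simp only [α]
    clear * -
    induction l with
    | nil => simp
    | cons h l ih =>
      rw [List.map_cons, List.sum_cons]
      refine (abs_add_le _ _).trans ?_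
      have : |(if x = y then 1 else 0 : ℤ) - (if x * h = y then 1 else 0)| ≤ 1 := by
        split_ifs <;> norm_num
      refine (add_le_add this ih).trans ?_
      rw [List.length_cons]
      push_cast
      linarith
  have hβb : ∀ x y, |β x y| ≤ Fintype.card H := by
    intro x y
    refine (Finset.abs_sum_le_sum_abs _ _).trans ?_
    have h1 : ∀ j ∈ Finset.range (orderOf h₁), |(if x * h₁ ^ j = y then 1 else 0 : ℤ)| ≤ 1 := by
      intro j _
      split_ifs <;> norm_num
    refine (Finset.sum_le_sum h1).trans ?_
    simp only [Finset.sum_const, Finset.card_range, nsmul_eq_mul, mul_one]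
    exact_mod_cast orderOf_le_card_univ
  have hentry : ∀ x y, |M x y| ≤
      Fintype.card H * (2 * l.length : ℤ) ^ 2 + Fintype.card H * (Fintype.card H : ℤ) ^ 2 := by
    have hprod : ∀ (N : Matrix H H ℤ) (B : ℤ), (∀ x y, |N x y| ≤ B) → ∀ x y,
        |(N.transpose * N) x y| ≤ Fintype.card H * B ^ 2 := by
      intro N B hN x y
      rw [Matrix.mul_apply]
      refine (Finset.abs_sum_le_sum_abs _ _).trans ?_
      refine (Finset.sum_le_card_nsmul _ _ (B ^ 2) fun z _ => ?_).trans (by simp)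
      rw [abs_mul, sq]
      exact mul_le_mul (hN _ _) (hN _ _) (abs_nonneg _) ((abs_nonneg _).trans (hN x y))
    intro x y
    exact (abs_add_le _ _).trans (add_le_add (hprod α _ hαb x y) (hprod β _ hβb x y))
  have := Matrix.det_le (A := M) (abv := AbsoluteValue.abs) hentry
  simp only [AbsoluteValue.abs_apply, Int.abs_eq_natAbs] at this
  unfold twistOrderBound
  rw [nsmul_eq_mul] at this
  exact_mod_cast this

theorem independentDegrees_replicate [Fintype H] (hχ : ∀ h, h ≠ 1 → IsUnit (χ h - 1))
    {b : ZMod n} {s : ℕ} (hb : twistOrderBound (Fintype.card H) s < addOrderOf b) :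
    IndependentDegrees χ (Multiset.replicate s b) := by
  intro T hT hsum p hp
  by_contra hne
  induction T using Quotient.inductionOn with
  | h L =>
    have hsnd : ∀ p ∈ L, p.2 = b := fun p hp =>
      Multiset.eq_of_mem_replicate (hT ▸ Multiset.mem_map_of_mem Prod.snd hp)
    have hlen : (L.map Prod.fst).length = s := by
      have := congrArg Multiset.card hT
      simpa using this
    have h1 : ((L.map Prod.fst).map fun h => χ h * b).sum = (L.map Prod.fst).length * b := by
      rw [hlen, List.map_map]
      simp only [Multiset.quot_mk_to_coe, Multiset.map_coe, Multiset.sum_coe,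
        Multiset.sum_replicate, nsmul_eq_mul] at hsum
      rw [← hsum]
      congr 1
      refine List.map_congr_left fun p hp => ?_
      simp [hsnd p hp]
    have := addOrderOf_le_of_twisted_sum hχ _ ⟨p.1, List.mem_map_of_mem hp, hne⟩ h1
    rw [hlen] at this
    omega

end Independence

/-! ### Words of graded operators and bounded solvability. -/

section Words

attribute [local instance] LieRing.ofAssociativeRing

variable {K V : Type*} [Field K] [AddCommGroup V] [Module K V] {n : ℕ}

/-- The components `g b` of a family of operators, closed under brackets, shift the components
`v a` of a family of subspaces, and `g 0` is trivial. -/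
structure IsGradedAction (v : ZMod n → Submodule K V)
    (g : ZMod n → Submodule K (Module.End K V)) : Prop where
  lie : IsLieGraded g
  act : ∀ a b, ∀ x ∈ g b, ∀ u ∈ v a, x u ∈ v (b + a)
  zero : g 0 = ⊥

/-- The submodule `Q` is invariant under all components of `g`. -/
def IsStableFor (g : ZMod n → Submodule K (Module.End K V)) (Q : Submodule K V) : Prop :=
  ∀ i, ∀ x ∈ g i, ∀ u ∈ Q, x u ∈ Q

/-- A list of operators labelled with their degrees. -/
def IsWord (g : ZMod n → Submodule K (Module.End K V)) (l : List (ZMod n × Module.End K V)) :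
    Prop :=
  ∀ p ∈ l, p.2 ∈ g p.1

def wordDegree (l : List (ZMod n × Module.End K V)) : ZMod n := (l.map Prod.fst).sum

def wordOp (l : List (ZMod n × Module.End K V)) : Module.End K V := (l.map Prod.snd).prod

variable {v : ZMod n → Submodule K V} {g : ZMod n → Submodule K (Module.End K V)}
  {Q : Submodule K V} {l l' : List (ZMod n × Module.End K V)}

theorem isWord_nil : IsWord g [] := fun _ h => absurd h List.not_mem_nil

theorem isWord_cons {p : ZMod n × Module.End K V} :
    IsWord g (p :: l) ↔ p.2 ∈ g p.1 ∧ IsWord g l := List.forall_mem_cons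

theorem isWord_append : IsWord g (l ++ l') ↔ IsWord g l ∧ IsWord g l' := List.forall_mem_append

theorem IsWord.perm (h : IsWord g l) (hl : l.Perm l') : IsWord g l' :=
  fun p hp => h p (hl.mem_iff.2 hp)

theorem IsWord.mono {g' : ZMod n → Submodule K (Module.End K V)} (hg : ∀ e, g e ≤ g' e)
    (h : IsWord g l) : IsWord g' l := fun p hp => hg _ (h p hp)

@[simp] theorem wordDegree_nil : wordDegree ([] : List (ZMod n × Module.End K V)) = 0 := rfl

@[simp] theorem wordDegree_cons (p : ZMod n × Module.End K V) :
    wordDegree (p :: l) = p.1 + wordDegree l := by simp [wordDegree]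

@[simp] theorem wordDegree_append : wordDegree (l ++ l') = wordDegree l + wordDegree l' := by
  simp [wordDegree]

theorem wordDegree_perm (hl : l.Perm l') : wordDegree l = wordDegree l' :=
  (hl.map _).sum_eq

theorem wordDegree_eq_nsmul {b : ZMod n} (hb : ∀ p ∈ l, p.1 = b) :
    wordDegree l = l.length • b := by
  rw [wordDegree, List.sum_eq_card_nsmul _ b (by simpa using fun a x h => hb _ h), List.length_map]

@[simp] theorem wordOp_nil : wordOp ([] : List (ZMod n × Module.End K V)) = 1 := rfl

@[simp] theorem wordOp_cons (p : ZMod n × Module.End K V) :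
    wordOp (p :: l) = p.2 * wordOp l := by simp [wordOp]

@[simp] theorem wordOp_append : wordOp (l ++ l') = wordOp l * wordOp l' := by
  simp [wordOp]

theorem IsStableFor.wordOp_mem (hQ : IsStableFor g Q) (hl : IsWord g l) {u : V} (hu : u ∈ Q) :
    wordOp l u ∈ Q := by
  induction l with
  | nil => exact hu
  | cons p l ih =>
    rw [isWord_cons] at hl
    rw [wordOp_cons]
    exact hQ _ _ hl.1 _ (ih hl.2)

theorem IsGradedAction.wordOp_mem (h : IsGradedAction v g) (hl : IsWord g l) {a : ZMod n} {u : V}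
    (hu : u ∈ v a) : wordOp l u ∈ v (wordDegree l + a) := by
  induction l with
  | nil => simpa using hu
  | cons p l ih =>
    rw [isWord_cons] at hl
    rw [wordOp_cons, wordDegree_cons, add_assoc]
    exact h.act _ _ _ hl.1 _ (ih hl.2)

variable {H : Type*} [Group H]

/-- Words of length `s` with degrees independent together with `a` map `v a` into `Q`. -/
def IsSelective (χ : H →* ZMod n) (v : ZMod n → Submodule K V)
    (g : ZMod n → Submodule K (Module.End K V)) (Q : Submodule K V) (s : ℕ) : Prop :=
  ∀ l, IsWord g l → l.length = s → ∀ a, ∀ u ∈ v a,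
    IndependentDegrees χ (a ::ₘ (l.map Prod.fst : List (ZMod n))) → wordOp l u ∈ Q

variable {χ : H →* ZMod n}

/-- The summands make `s` copies of `b` independent, make `q ^ (s + 1) + 1` translates `j • b + a`
distinct, and leave room for `s + j` letters. -/
def powerBound (q s : ℕ) : ℕ := twistOrderBound q s + q ^ (s + 1) + s + 1

/-- Some degree `j • b + a` with `j ≤ q ^ (s + 1)` avoids the exceptional set of `s` copies of `b`.
After the last `j` letters have brought `u` to that degree, the next `s` letters form an independent
word. -/
theorem wordOp_mem_of_powerBound_le [Fintype H] (hχ : ∀ h, h ≠ 1 → IsUnit (χ h - 1))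
    (h : IsGradedAction v g) (hQ : IsStableFor g Q) {s : ℕ} (hs : IsSelective χ v g Q s)
    {b : ZMod n} (hb : powerBound (Fintype.card H) s ≤ addOrderOf b)
    (hl : IsWord g l) (hlb : ∀ p ∈ l, p.1 = b) (hlen : powerBound (Fintype.card H) s ≤ l.length)
    {a : ZMod n} {u : V} (hu : u ∈ v a) : wordOp l u ∈ Q := by
  classical
  unfold powerBound at hb hlen
  obtain ⟨D, hD, hDj⟩ := exists_finset_not_independentDegrees_cons hχ
    (independentDegrees_replicate hχ (b := b) (s := s) (by omega))
  rw [Multiset.card_replicate] at hD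
  set q := Fintype.card H
  obtain ⟨j, hj, hjD⟩ : ∃ j ∈ Finset.range (q ^ (s + 1) + 1), j • b + a ∉ D := by
    by_contra! hcon
    have := Finset.card_le_card_of_injOn (s := Finset.range (q ^ (s + 1) + 1)) (t := D)
      (fun j => j • b + a) hcon (by
        intro i hi j hj hij
        have hij' : i • b = j • b := add_right_cancel hij
        simp only [Finset.coe_range, Set.mem_Iio] at hi hj
        exact nsmul_injOn_Iio_addOrderOf (by simp only [Set.mem_Iio]; omega)
          (by simp only [Set.mem_Iio]; omega) hij')
    rw [Finset.card_range] at this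
    omega
  rw [Finset.mem_range] at hj
  obtain ⟨l₁, l₂, l₃, rfl, h₂, h₃⟩ : ∃ l₁ l₂ l₃, l = l₁ ++ (l₂ ++ l₃) ∧ l₂.length = s ∧
      l₃.length = j := by
    refine ⟨l.take (l.length - (s + j)), (l.drop (l.length - (s + j))).take s,
      (l.drop (l.length - (s + j))).drop s, by simp, ?_, ?_⟩
    · rw [List.length_take, List.length_drop]; omega
    · rw [List.length_drop, List.length_drop]; omega
  rw [isWord_append, isWord_append] at hl
  simp only [List.forall_mem_append] at hlb
  rw [wordOp_append, wordOp_append]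
  refine hQ.wordOp_mem hl.1 (hs l₂ hl.2.1 h₂ (j • b + a) _ ?_ ?_)
  · rw [← h₃, ← wordDegree_eq_nsmul hlb.2.2]
    exact h.wordOp_mem hl.2.2 hu
  · have : ((l₂.map Prod.fst : List (ZMod n)) : Multiset (ZMod n)) = Multiset.replicate s b := by
      rw [Multiset.eq_replicate]
      refine ⟨by simpa using h₂, fun d hd => ?_⟩
      obtain ⟨p, hp, rfl⟩ := List.mem_map.1 (Multiset.mem_coe.1 hd)
      exact hlb.2.1 p hp
    rw [this]
    exact hDj _ hjD

/-- The degrees `j₁ d₁ + ⋯ + jₘ dₘ + a` with `jᵢ < κ`. -/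
def degreeBox (κ : ℕ) : List (ZMod n) → ZMod n → Finset (ZMod n)
  | [], a => {a}
  | d :: D, a => (Finset.range κ).biUnion fun j => degreeBox κ D (j • d + a)

theorem card_degreeBox_le (κ : ℕ) (D : List (ZMod n)) (a : ZMod n) :
    (degreeBox κ D a).card ≤ κ ^ D.length := by
  induction D generalizing a with
  | nil => simp [degreeBox]
  | cons d D ih =>
    refine Finset.card_biUnion_le.trans ?_
    refine (Finset.sum_le_card_nsmul _ _ _ fun j _ => ih _).trans ?_
    rw [Finset.card_range, smul_eq_mul, List.length_cons, pow_succ']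

/-- Sort a word so that the letters with equal degrees in the given list are adjacent. -/
def groupByDegree : List (ZMod n) → List (ZMod n × Module.End K V) →
    List (ZMod n × Module.End K V)
  | [], l => l
  | d :: D, l => groupByDegree D (l.filter (fun p => p.1 ≠ d)) ++ l.filter (fun p => p.1 = d)

theorem filter_ne_append_filter_eq_perm (d : ZMod n) (l : List (ZMod n × Module.End K V)) :
    (l.filter (fun p => p.1 ≠ d) ++ l.filter (fun p => p.1 = d)).Perm l := by
  have := List.filter_append_perm (fun p : ZMod n × Module.End K V => p.1 ≠ d) l
  simpa using this

theorem groupByDegree_perm (D : List (ZMod n)) (l : List (ZMod n × Module.End K V)) :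
    (groupByDegree D l).Perm l := by
  induction D generalizing l with
  | nil => exact List.Perm.refl _
  | cons d D ih => exact ((ih _).append_right _).trans (filter_ne_append_filter_eq_perm d l)

/-- In a sorted word each degree `d` contributes a multiple of `d`. Either `d` has small order and
the multiplicity can be reduced modulo it, or a multiplicity of at least `κ` already forces the
image into `Q`. -/
theorem wordOp_groupByDegree_mem_or [Fintype H] [NeZero n]
    (hχ : ∀ h, h ≠ 1 → IsUnit (χ h - 1))
    (h : IsGradedAction v g) (hQ : IsStableFor g Q) {s : ℕ} (hs : IsSelective χ v g Q s)
    (D : List (ZMod n)) (l : List (ZMod n × Module.End K V)) (hl : IsWord g l)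
    (hlD : ∀ p ∈ l, p.1 ∈ D) (a : ZMod n) (u : V) (hu : u ∈ v a) :
    wordOp (groupByDegree D l) u ∈ Q ∨
      wordDegree l + a ∈ degreeBox (powerBound (Fintype.card H) s) D a := by
  induction D generalizing l a u with
  | nil =>
    have : l = [] := List.eq_nil_iff_forall_not_mem.2 fun p hp => List.not_mem_nil (hlD p hp)
    subst this
    right
    simp [degreeBox]
  | cons d D ih =>
    set κ := powerBound (Fintype.card H) s with hκ
    set l₁ := l.filter (fun p => p.1 ≠ d) with hl₁
    set l₂ := l.filter (fun p => p.1 = d) with hl₂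
    have hperm : (l₁ ++ l₂).Perm l := filter_ne_append_filter_eq_perm d l
    have hw := isWord_append.1 (hl.perm hperm.symm)
    have hd₂ : ∀ p ∈ l₂, p.1 = d := fun p hp => by simpa using (List.mem_filter.1 hp).2
    have hg : wordOp (groupByDegree (d :: D) l) u
        = wordOp (groupByDegree D l₁) (wordOp l₂ u) := by
      simp [groupByDegree, hl₁, hl₂]
    have hcase : wordOp l₂ u ∈ Q ∨ ∃ j < κ, j • d = l₂.length • d := by
      rcases le_total (addOrderOf d) κ with hle | hle
      · exact Or.inr ⟨_, (Nat.mod_lt _ (addOrderOf_pos d)).trans_le hle, mod_addOrderOf_nsmul d _⟩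
      · rcases lt_or_ge l₂.length κ with hlt | hge
        · exact Or.inr ⟨_, hlt, rfl⟩
        · exact Or.inl (wordOp_mem_of_powerBound_le hχ h hQ hs hle hw.2 hd₂ hge hu)
    rw [hg]
    rcases hcase with hmem | ⟨j, hj, hjd⟩
    · exact Or.inl (hQ.wordOp_mem (hw.1.perm (groupByDegree_perm D l₁).symm) hmem)
    · have hu' := h.wordOp_mem hw.2 hu
      refine (ih l₁ hw.1 (fun p hp => ?_) _ _ hu').imp_right fun hmem => ?_
      · have := List.mem_filter.1 hp
        exact (List.mem_cons.1 (hlD p this.1)).resolve_left (by simpa using this.2)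
      · rw [wordDegree_eq_nsmul hd₂, ← hjd] at hmem
        rw [← wordDegree_perm hperm, wordDegree_append, wordDegree_eq_nsmul hd₂, ← hjd, add_assoc]
        exact Finset.mem_biUnion.2 ⟨j, Finset.mem_range.2 hj, hmem⟩

/-- Exchanging neighbouring letters costs a word in which they are replaced by their bracket:
shorter by one letter and of the same degree. -/
theorem wordOp_sub_wordOp_mem (h : IsLieGraded g) (hl : l.Perm l') (hlw : IsWord g l)
    (p : List (ZMod n × Module.End K V)) (hp : IsWord g p) (u : V)
    (hshort : ∀ w, IsWord g w → w.length + 1 = p.length + l.length →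
      wordDegree w = wordDegree p + wordDegree l → wordOp w u ∈ Q) :
    wordOp (p ++ l) u - wordOp (p ++ l') u ∈ Q := by
  induction hl generalizing p with
  | nil => simp
  | @cons x l l' _ ih =>
    rw [isWord_cons] at hlw
    have := ih hlw.2 (p ++ [x]) (isWord_append.2 ⟨hp, isWord_cons.2 ⟨hlw.1, isWord_nil⟩⟩) (by
      intro w hw hlen hdeg
      refine hshort w hw ?_ ?_
      · simp only [List.length_append, List.length_cons, List.length_nil] at hlen ⊢
        omega
      · simpa [add_assoc] using hdeg)
    simpa using this
  | swap x y l =>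
    rw [isWord_cons, isWord_cons] at hlw
    have := hshort (p ++ (y.1 + x.1, ⁅y.2, x.2⁆) :: l)
      (isWord_append.2 ⟨hp, isWord_cons.2 ⟨h _ _ _ hlw.1 _ hlw.2.1, hlw.2.2⟩⟩) (by
        simp only [List.length_append, List.length_cons]; omega) (by simp [add_assoc])
    simpa [Ring.lie_def, sub_mul, mul_assoc, map_sub] using this
  | trans h₁ h₂ ih₁ ih₂ =>
    have := add_mem (ih₁ hlw p hp hshort) (ih₂ (hlw.perm h₁) p hp (by
      rw [← wordDegree_perm h₁, ← h₁.length_eq]; exact hshort))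
    simpa using this

/-- If `u` is killed modulo `Q` by all components of `g` with degrees outside `D`, then only
boundedly many components of the module generated by `u` are nontrivial modulo `Q`. -/
theorem wordOp_mem_or_mem_degreeBox [Fintype H] [NeZero n]
    (hχ : ∀ h, h ≠ 1 → IsUnit (χ h - 1))
    (h : IsGradedAction v g) (hQ : IsStableFor g Q) {s : ℕ} (hs : IsSelective χ v g Q s)
    (D : Finset (ZMod n)) {a : ZMod n} {u : V} (hu : u ∈ v a)
    (huD : ∀ j ∉ D, ∀ x ∈ g j, x u ∈ Q) (hl : IsWord g l) :
    wordOp l u ∈ Q ∨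
      wordDegree l + a ∈ degreeBox (powerBound (Fintype.card H) s) D.toList a := by
  by_contra! hcon
  obtain ⟨hcon, hdeg⟩ := hcon
  refine hcon ?_
  obtain ⟨m, hm⟩ : ∃ m, l.length = m := ⟨_, rfl⟩
  induction m generalizing l with
  | zero =>
    obtain rfl := List.length_eq_zero_iff.1 hm
    have := wordOp_groupByDegree_mem_or hχ h hQ hs D.toList [] isWord_nil (by simp) a u hu
    rw [List.perm_nil.1 (groupByDegree_perm D.toList [])] at this
    exact this.resolve_right hdeg
  | succ m ih =>
    -- Shorter words of the same degree map `u` into `Q` by induction, so the letters may be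
    -- permuted freely: either all are sorted, or a letter of degree outside `D` is brought to act
    -- first.
    have hshort : ∀ w, IsWord g w → w.length + 1 = ([] : List (ZMod n × Module.End K V)).length
        + l.length → wordDegree w = wordDegree ([] : List (ZMod n × Module.End K V))
        + wordDegree l → wordOp w u ∈ Q := by
      intro w hw hlen hwd
      simp only [List.length_nil, zero_add, wordDegree_nil] at hlen hwd
      by_contra hcon'
      exact hcon' (ih hw hcon' (by rwa [hwd]) (by omega))
    have key : ∀ l', l.Perm l' → wordOp l' u ∈ Q → wordOp l u ∈ Q := by
      intro l' hll' hl'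
      have := wordOp_sub_wordOp_mem (Q := Q) h.lie hll' hl [] isWord_nil u hshort
      simpa using add_mem this hl'
    by_cases hD : ∀ p ∈ l, p.1 ∈ D.toList
    · refine key _ (groupByDegree_perm D.toList l).symm ?_
      exact (wordOp_groupByDegree_mem_or hχ h hQ hs D.toList l hl hD a u hu).resolve_right hdeg
    · push Not at hD
      obtain ⟨p, hp, hpD⟩ := hD
      obtain ⟨l₁, l₂, rfl⟩ := List.append_of_mem hp
      have hperm : (l₁ ++ p :: l₂).Perm ((l₁ ++ l₂) ++ [p]) := by
        refine List.perm_middle.trans ?_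
        exact (List.perm_append_singleton p (l₁ ++ l₂)).symm
      refine key _ hperm ?_
      have hw := isWord_append.1 (hl.perm hperm)
      rw [wordOp_append]
      refine hQ.wordOp_mem hw.1 ?_
      have := huD p.1 (by simpa using hpD) p.2 (hl p hp)
      simpa using this

/-- The exponent bounds the number of differences of two degrees in a box over at most `q ^ (s + 2)`
degrees. The final `+ 1` is the bracket that composes two maps `V → Q' → Q`. -/
def solvabilityBound (q : ℕ) : ℕ → ℕ
  | 0 => 0
  | s + 1 => max (solvabilityBound q s)
      (2 ^ ((powerBound q (s + 1) ^ q ^ (s + 2)) ^ 2)) + 1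

theorem iterate_derivedFamily_apply_mem [Fintype H] [NeZero n]
    (hχ : ∀ h, h ≠ 1 → IsUnit (χ h - 1)) (h : IsGradedAction v g) (s : ℕ) {Q : Submodule K V}
    (hQ : IsStableFor g Q) (h0 : v 0 ≤ Q) (hs : IsSelective χ v g Q s) {e : ZMod n}
    {x : Module.End K V} (hx : x ∈ derivedFamily^[solvabilityBound (Fintype.card H) s] g e)
    {a : ZMod n} {u : V} (hu : u ∈ v a) : x u ∈ Q := by
  classical
  induction s generalizing Q e x a u with
  | zero =>
    -- A single nonzero degree is independent, so selectivity for the empty word already puts every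
    -- component in `Q`.
    have hv : ∀ a, v a ≤ Q := by
      intro a u hu
      by_cases ha : a = 0
      · exact h0 (ha ▸ hu)
      · exact hs [] isWord_nil rfl a u hu (by simpa using independentDegrees_singleton hχ ha)
    exact hQ _ _ hx _ (hv a hu)
  | succ s ih =>
    set q := Fintype.card H with hq
    set f := 2 ^ ((powerBound q (s + 1) ^ q ^ (s + 2)) ^ 2) with hf
    -- the module generated by the images of independent words of length `s`
    let Q' : Submodule K V := Q ⊔ Submodule.span K {t | ∃ w l, IsWord g w ∧ IsWord g l ∧
      l.length = s ∧ ∃ a, ∃ u ∈ v a,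
        IndependentDegrees χ (a ::ₘ (l.map Prod.fst : List (ZMod n))) ∧
        t = wordOp w (wordOp l u)}
    have hQ' : IsStableFor g Q' := by
      intro i x hx u hu
      obtain ⟨y, hy, z, hz, rfl⟩ := Submodule.mem_sup.1 hu
      rw [map_add]
      refine add_mem (Submodule.mem_sup_left (hQ i x hx y hy)) ?_
      clear hu
      induction hz using Submodule.span_induction with
      | zero => rw [map_zero]; exact zero_mem _
      | add _ _ _ _ h h' => rw [map_add]; exact add_mem h h'
      | smul t _ _ h => rw [map_smul]; exact Submodule.smul_mem _ _ h
      | mem t ht =>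
        obtain ⟨w, l, hw, hl, hlen, a, u, hu, hi, rfl⟩ := ht
        exact Submodule.mem_sup_right (Submodule.subset_span
          ⟨(i, x) :: w, l, isWord_cons.2 ⟨hx, hw⟩, hl, hlen, a, u, hu, hi, by simp⟩)
    have hs' : IsSelective χ v g Q' s := by
      intro l hl hlen a u hu hi
      exact Submodule.mem_sup_right (Submodule.subset_span
        ⟨[], l, isWord_nil, hl, hlen, a, u, hu, hi, by simp⟩)
    have hkill : ∀ e, ∀ x ∈ derivedFamily^[f] g e, ∀ t ∈ Q', x t ∈ Q := by
      intro e x hx t ht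
      obtain ⟨y, hy, z, hz, rfl⟩ := Submodule.mem_sup.1 ht
      rw [map_add]
      refine add_mem (hQ e x (iterate_derivedFamily_le h.lie (Nat.zero_le _) e hx) y hy) ?_
      clear ht
      induction hz using Submodule.span_induction with
      | zero => rw [map_zero]; exact zero_mem _
      | add _ _ _ _ h h' => rw [map_add]; exact add_mem h h'
      | smul t _ _ h => rw [map_smul]; exact Submodule.smul_mem _ _ h
      | mem t ht =>
        obtain ⟨w, l, hw, hl, hlen, a, u, hu, hi, rfl⟩ := ht
        -- A letter of degree outside `D` extends `l` to an independent word of length `s + 1`,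
        -- which maps into `Q`. So `wordOp l u` is killed modulo `Q` by all degrees outside `D`.
        obtain ⟨D, hD, hDj⟩ := exists_finset_not_independentDegrees_cons hχ hi
        rw [Multiset.card_cons, Multiset.coe_card, List.length_map, hlen, ← hq] at hD
        have hbox := fun (w : List (ZMod n × Module.End K V)) (hw : IsWord g w) =>
          wordOp_mem_or_mem_degreeBox hχ h hQ hs D (h.wordOp_mem hl hu) (by
            intro j hj x hx
            have := hs ((j, x) :: l) (isWord_cons.2 ⟨hx, hl⟩) (by simp [hlen]) a u hu (by
              have := hDj j hj
              rw [Multiset.cons_swap] at this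
              simpa using this)
            simpa using this) hw
        rw [← hq] at hbox
        set u' := wordOp l u
        set a' := wordDegree l + a
        set B := degreeBox (powerBound q (s + 1)) D.toList a' with hB
        let J : Submodule K V := Submodule.span K {t | ∃ w, IsWord g w ∧ t = wordOp w u'}
        have hJ : IsStableFor g J := by
          intro i x hx t ht
          induction ht using Submodule.span_induction with
          | zero => rw [map_zero]; exact zero_mem _
          | add _ _ _ _ h h' => rw [map_add]; exact add_mem h h'
          | smul t _ _ h => rw [map_smul]; exact Submodule.smul_mem _ _ h
          | mem t ht =>
            obtain ⟨w, hw, rfl⟩ := ht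
            exact Submodule.subset_span ⟨(i, x) :: w, isWord_cons.2 ⟨hx, hw⟩, by simp⟩
        -- Kreknin's theorem is applied modulo the operators annihilating the image of `J` modulo
        -- `Q`. A degree acts nontrivially there only if it is a difference of two degrees in `B`.
        let Z : Submodule K (Module.End K V) :=
          { carrier := {x | (∀ y ∈ J, x y ∈ Q) ∧ ∀ y ∈ Q, x y ∈ Q}
            zero_mem' := ⟨fun _ _ => zero_mem _, fun _ _ => zero_mem _⟩
            add_mem' := fun hx hy => ⟨fun z hz => add_mem (hx.1 z hz) (hy.1 z hz),
              fun z hz => add_mem (hx.2 z hz) (hy.2 z hz)⟩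
            smul_mem' := fun t x hx => ⟨fun z hz => Submodule.smul_mem _ t (hx.1 z hz),
              fun z hz => Submodule.smul_mem _ t (hx.2 z hz)⟩ }
        have hZZ : ∀ x ∈ Z, ∀ z ∈ Z, ⁅x, z⁆ ∈ Z := fun x hx z hz =>
          ⟨fun y hy => sub_mem (hx.2 _ (hz.1 y hy)) (hz.2 _ (hx.1 y hy)),
            fun y hy => sub_mem (hx.2 _ (hz.2 y hy)) (hz.2 _ (hx.2 y hy))⟩
        have hZ : ∀ i, ∀ x ∈ g i, ∀ z ∈ Z, ⁅x, z⁆ ∈ Z := fun i x hx z hz =>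
          ⟨fun y hy => sub_mem (hQ i x hx _ (hz.1 y hy)) (hz.1 _ (hJ i x hx y hy)),
            fun y hy => sub_mem (hQ i x hx _ (hz.2 y hy)) (hz.2 _ (hQ i x hx y hy))⟩
        have hΔ : ∀ i ∉ (B ×ˢ B).image (fun p => p.1 - p.2), g i ≤ Z := by
          intro i hi x hx
          refine ⟨fun y hy => ?_, hQ i x hx⟩
          induction hy using Submodule.span_induction with
          | zero => rw [map_zero]; exact zero_mem _
          | add _ _ _ _ h h' => rw [map_add]; exact add_mem h h'
          | smul t _ _ h => rw [map_smul]; exact Submodule.smul_mem _ _ h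
          | mem t ht =>
            obtain ⟨w, hw, rfl⟩ := ht
            rcases hbox w hw with hmem | hmem
            · exact hQ i x hx _ hmem
            · rcases hbox ((i, x) :: w) (isWord_cons.2 ⟨hx, hw⟩) with hmem' | hmem'
              · simpa using hmem'
              · refine absurd (Finset.mem_image.2 ⟨(_, _), Finset.mem_product.2 ⟨hmem', hmem⟩, ?_⟩) hi
                simp
        have hcard : ((B ×ˢ B).image (fun p => p.1 - p.2)).card
            ≤ (powerBound q (s + 1) ^ q ^ (s + 2)) ^ 2 := by
          refine Finset.card_image_le.trans ?_
          rw [Finset.card_product, sq]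
          have hBc : B.card ≤ powerBound q (s + 1) ^ q ^ (s + 2) := by
            refine (card_degreeBox_le _ _ _).trans (Nat.pow_le_pow_right ?_ ?_)
            · unfold powerBound; omega
            · rw [Finset.length_toList]; exact hD
          exact Nat.mul_le_mul hBc hBc
        have := iterate_derivedFamily_le_of_card_le hZZ _ h.lie hZ (by rw [h.zero]; exact bot_le)
          hΔ hcard e hx
        exact this.1 _ (Submodule.subset_span ⟨w, hw, rfl⟩)
    rw [solvabilityBound, Function.iterate_succ_apply'] at hx
    have hx1 : ∀ e, ∀ x ∈ derivedFamily^[max (solvabilityBound q s) f] g e, ∀ a, ∀ u ∈ v a,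
        x u ∈ Q' := fun e x hx a u hu =>
      ih hQ' (h0.trans le_sup_left) hs'
        (iterate_derivedFamily_le h.lie (le_max_left _ _) e hx) hu
    have hx2 : ∀ e, ∀ x ∈ derivedFamily^[max (solvabilityBound q s) f] g e, ∀ t ∈ Q', x t ∈ Q :=
      fun e x hx => hkill e x (iterate_derivedFamily_le h.lie (le_max_right _ _) e hx)
    induction hx using Submodule.span_induction with
    | zero => exact zero_mem _
    | add _ _ _ _ h h' => exact add_mem h h'
    | smul t _ _ h => exact Submodule.smul_mem _ _ h
    | mem z hz =>
      obtain ⟨i, j, -, x, hx, y, hy, rfl⟩ := hz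
      exact sub_mem (hx2 _ x hx _ (hx1 _ y hy _ u hu)) (hx2 _ y hy _ (hx1 _ x hx _ u hu))

end Words

/-! ### Consequences of the trace identity. -/

section FrobeniusAction

attribute [local instance] LieRing.ofAssociativeRing

variable {K V : Type*} [Field K] [AddCommGroup V] [Module K V] {n : ℕ} {H : Type*} [Group H]

/-- The conjugate of the operator `x` by `ρ h`. -/
def conjOp (ρ : H →* Module.End K V) (h : H) (x : Module.End K V) : Module.End K V :=
  ρ h * x * ρ h⁻¹

theorem conjOp_lie (ρ : H →* Module.End K V) (h : H) (x y : Module.End K V) :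
    conjOp ρ h ⁅x, y⁆ = ⁅conjOp ρ h x, conjOp ρ h y⁆ := by
  have key : ∀ x y, conjOp ρ h (x * y) = conjOp ρ h x * conjOp ρ h y := by
    intro x y
    have h1 : ρ h⁻¹ * ρ h = 1 := by rw [← map_mul, inv_mul_cancel, map_one]
    simp only [conjOp, mul_assoc]
    rw [← mul_assoc (ρ h⁻¹) (ρ h), h1, one_mul]
  have hsub : ∀ x y, conjOp ρ h (x - y) = conjOp ρ h x - conjOp ρ h y := fun x y => by
    simp only [conjOp, mul_sub, sub_mul]
  rw [Ring.lie_def, Ring.lie_def, hsub, key, key]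

theorem conjOp_one (ρ : H →* Module.End K V) (x : Module.End K V) : conjOp ρ 1 x = x := by
  simp [conjOp]

/-- The family `g` is permuted by the operators `ρ h` according to the character `χ`. -/
def IsConjStable (χ : H →* ZMod n) (ρ : H →* Module.End K V)
    (g : ZMod n → Submodule K (Module.End K V)) : Prop :=
  ∀ h b, ∀ x ∈ g b, conjOp ρ h x ∈ g (χ h * b)

theorem IsConjStable.derivedFamily {χ : H →* ZMod n} {ρ : H →* Module.End K V}
    {g : ZMod n → Submodule K (Module.End K V)} (hg : IsConjStable χ ρ g) :
    IsConjStable χ ρ (derivedFamily g) := by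
  intro h b x hx
  induction hx using Submodule.span_induction with
  | zero => simp [conjOp]
  | add x y _ _ hx hy =>
    have : conjOp ρ h (x + y) = conjOp ρ h x + conjOp ρ h y := by
      simp only [conjOp, mul_add, add_mul]
    rw [this]; exact add_mem hx hy
  | smul t x _ hx =>
    have : conjOp ρ h (t • x) = t • conjOp ρ h x := by simp [conjOp]
    rw [this]; exact Submodule.smul_mem _ t hx
  | mem z hz =>
    obtain ⟨u, w, rfl, x, hx, y, hy, rfl⟩ := hz
    rw [conjOp_lie, mul_add]
    exact lie_mem_derivedFamily (hg h u x hx) (hg h w y hy)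

/-- A graded action without fixed points of degree zero, together with a group permuting the
components, such that products of `c` traces of homogeneous operators kill traces. -/
structure IsFrobeniusAction [Fintype H] (χ : H →* ZMod n) (ρ : H →* Module.End K V) (c : ℕ)
    (v : ZMod n → Submodule K V) (g : ZMod n → Submodule K (Module.End K V)) : Prop where
  graded : IsGradedAction v g
  isUnit : ∀ h, h ≠ 1 → IsUnit (χ h - 1)
  independent : iSupIndep v
  zero : v 0 = ⊥
  rho_mem : ∀ h a, ∀ u ∈ v a, ρ h u ∈ v (χ h * a)
  conj : IsConjStable χ ρ g
  trace : ∀ x : Fin c → Module.End K V, (∀ i, ∃ b, x i ∈ g b) → ∀ a, ∀ u ∈ v a,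
    (List.ofFn fun i => ∑ h, conjOp ρ h (x i)).prod (∑ h, ρ h u) = 0

variable {χ : H →* ZMod n} {ρ : H →* Module.End K V}
  {v : ZMod n → Submodule K V} {g : ZMod n → Submodule K (Module.End K V)}

theorem prod_ofFn_conjOp_mem (h : IsGradedAction v g) (hconj : IsConjStable χ ρ g)
    (hρ : ∀ h a, ∀ u ∈ v a, ρ h u ∈ v (χ h * a))
    {m : ℕ} {x : Fin m → Module.End K V} {b : Fin m → ZMod n} (hx : ∀ i, x i ∈ g (b i))
    {a : ZMod n} {u : V} (hu : u ∈ v a) (t : H) (τ : Fin m → H) :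
    (List.ofFn fun i => conjOp ρ (τ i) (x i)).prod (ρ t u) ∈ v (∑ i, χ (τ i) * b i + χ t * a) := by
  have hw : IsWord g (List.ofFn fun i => (χ (τ i) * b i, conjOp ρ (τ i) (x i))) := by
    intro p hp
    obtain ⟨i, rfl⟩ := List.mem_ofFn.1 hp
    exact hconj _ _ _ (hx i)
  have := h.wordOp_mem hw (hρ t a u hu)
  simpa [wordOp, wordDegree, List.map_ofFn, Function.comp_def, List.sum_ofFn] using this

variable [Fintype H] {c : ℕ}

theorem IsFrobeniusAction.sum_filter_degree_eq_zero [NeZero n] (h : IsFrobeniusAction χ ρ c v g)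
    {x : Fin c → Module.End K V} {b : Fin c → ZMod n} (hx : ∀ i, x i ∈ g (b i))
    {a : ZMod n} {u : V} (hu : u ∈ v a) (e : ZMod n) :
    ∑ p : H × (Fin c → H) with ∑ i, χ (p.2 i) * b i + χ p.1 * a = e,
      (List.ofFn fun i => conjOp ρ (p.2 i) (x i)).prod (ρ p.1 u) = 0 := by
  classical
  have h0 := h.trace x (fun i => ⟨_, hx i⟩) a u hu
  have hexp := (MultilinearMap.mkPiAlgebraFin K c (Module.End K V)).map_sum
    (fun i (t : H) => conjOp ρ t (x i))
  simp only [MultilinearMap.mkPiAlgebraFin_apply] at hexp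
  rw [hexp, map_sum] at h0
  simp only [LinearMap.sum_apply] at h0
  rw [← Fintype.sum_prod_type' (f := fun (t : H) (τ : Fin c → H) =>
    (List.ofFn fun i => conjOp ρ (τ i) (x i)).prod (ρ t u)),
    ← Finset.sum_fiberwise _ (fun p : H × (Fin c → H) => ∑ i, χ (p.2 i) * b i + χ p.1 * a)] at h0
  refine (iSupIndep_iff_finsetSum_eq_zero_imp_eq_zero v).1 h.independent Finset.univ _
    (fun e _ => ?_) h0 e (Finset.mem_univ _)
  refine sum_mem fun p hp => ?_
  rw [← (Finset.mem_filter.1 hp).2]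
  exact prod_ofFn_conjOp_mem h.graded h.conj h.rho_mem hx hu p.1 p.2

/-- Independence says that exactly one term of the expanded trace identity has the untwisted degree,
namely the word itself. -/
theorem IsFrobeniusAction.isSelective [NeZero n] (h : IsFrobeniusAction χ ρ c v g) :
    IsSelective χ v g ⊥ c := by
  classical
  intro l hl hlen a u hu hi
  obtain ⟨p, rfl⟩ : ∃ p : Fin c → ZMod n × Module.End K V, l = List.ofFn p := by
    subst hlen
    exact ⟨l.get, (List.ofFn_get l).symm⟩
  have hx : ∀ i, (p i).2 ∈ g (p i).1 := fun i => hl _ (List.mem_ofFn.2 ⟨i, rfl⟩)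
  have h0 := h.sum_filter_degree_eq_zero hx hu (∑ i, (p i).1 + a)
  have hfil : (Finset.univ.filter fun r : H × (Fin c → H) =>
      ∑ i, χ (r.2 i) * (p i).1 + χ r.1 * a = ∑ i, (p i).1 + a) = {(1, fun _ => 1)} := by
    ext ⟨t, τ⟩
    simp only [Finset.mem_filter, Finset.mem_univ, true_and, Finset.mem_singleton]
    constructor
    · intro hs
      have := hi ((t, a) ::ₘ ((List.ofFn fun i => (τ i, (p i).1) : List _) : Multiset _))
        (by simp [List.map_ofFn, Function.comp_def]) (by
          simpa [List.map_ofFn, Function.comp_def, List.sum_ofFn, add_comm] using hs)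
      have h1 : t = 1 := this (t, a) (Multiset.mem_cons_self _ _)
      have h2 : ∀ i, τ i = 1 := fun i => this (τ i, (p i).1)
        (Multiset.mem_cons_of_mem (Multiset.mem_coe.2 (List.mem_ofFn.2 ⟨i, rfl⟩)))
      rw [h1, funext h2]
    · rintro h1
      obtain ⟨rfl, rfl⟩ := Prod.mk.inj h1
      simp
  rw [hfil, Finset.sum_singleton] at h0
  simpa [wordOp, List.map_ofFn, Function.comp_def, conjOp_one] using h0

/-- The trace of `x` twisted by the `j`-th power of the character `ζ`. -/
def twistedTrace (χ : H →* ZMod n) (ζ : AddChar (ZMod n) K) (ρ : H →* Module.End K V)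
    (b : ZMod n) (j : ℕ) (x : Module.End K V) : Module.End K V :=
  ∑ t, ζ (χ t * b) ^ j • conjOp ρ t x

theorem AddChar.apply_sum {A R ι : Type*} [AddCommMonoid A] [CommMonoid R] (ζ : AddChar A R)
    (s : Finset ι) (f : ι → A) : ζ (∑ i ∈ s, f i) = ∏ i ∈ s, ζ (f i) := by
  classical
  induction s using Finset.induction_on with
  | empty => simp
  | insert i s hi ih => rw [Finset.sum_insert hi, Finset.prod_insert hi, AddChar.map_add_eq_mul, ih]

/-- Terms whose twisted operator degrees have the same sum `s` carry the same coefficient `ζ s ^ j`,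
so the trace identity can be applied to each such group. -/
theorem IsFrobeniusAction.prod_twistedTrace_apply [NeZero n] (h : IsFrobeniusAction χ ρ c v g)
    (ζ : AddChar (ZMod n) K) {a b : ZMod n} (hab : ¬ b ∣ a) (j : ℕ)
    {l : List (Module.End K V)} (hlen : l.length = c) (hl : ∀ x ∈ l, x ∈ g b)
    {u : V} (hu : u ∈ v a) : (l.map (twistedTrace χ ζ ρ b j)).prod u = 0 := by
  classical
  obtain ⟨x, rfl⟩ : ∃ x : Fin c → Module.End K V, l = List.ofFn x := by
    subst hlen
    exact ⟨l.get, (List.ofFn_get l).symm⟩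
  have hx : ∀ i, x i ∈ g b := fun i => hl _ (List.mem_ofFn.2 ⟨i, rfl⟩)
  have hexp := (MultilinearMap.mkPiAlgebraFin K c (Module.End K V)).map_sum
    (fun i (t : H) => ζ (χ t * b) ^ j • conjOp ρ t (x i))
  simp only [MultilinearMap.map_smul_univ, MultilinearMap.mkPiAlgebraFin_apply] at hexp
  rw [List.map_ofFn]
  change (List.ofFn fun i => ∑ t, ζ (χ t * b) ^ j • conjOp ρ t (x i)).prod u = 0
  rw [hexp, LinearMap.sum_apply,
    ← Finset.sum_fiberwise _ (fun τ : Fin c → H => ∑ i, χ (τ i) * b)]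
  refine Finset.sum_eq_zero fun s _ => ?_
  have hζ : ∀ τ ∈ Finset.univ.filter (fun τ : Fin c → H => ∑ i, χ (τ i) * b = s),
      ((∏ i, ζ (χ (τ i) * b) ^ j) • (List.ofFn fun i => conjOp ρ (τ i) (x i)).prod) u
        = ζ s ^ j • (List.ofFn fun i => conjOp ρ (τ i) (x i)).prod u := by
    intro τ hτ
    rw [Finset.prod_pow, ← AddChar.apply_sum, (Finset.mem_filter.1 hτ).2, LinearMap.smul_apply]
  rw [Finset.sum_congr rfl hζ, ← Finset.smul_sum]
  -- In degree `s + a` of the trace identity a term with `u` twisted by `t ≠ 1` would give `b ∣ (χ t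
  -- - 1) * a`, hence `b ∣ a`. Only `t = 1` contributes.
  by_cases hs : b ∣ s
  · have h0 := h.sum_filter_degree_eq_zero hx hu (s + a)
    rw [Finset.sum_filter, Fintype.sum_prod_type, Finset.sum_eq_single 1] at h0
    · rw [Finset.sum_filter]
      simp only [map_one, one_mul, add_left_inj, Module.End.one_apply] at h0
      rw [h0, smul_zero]
    · intro t _ ht
      refine Finset.sum_eq_zero fun τ _ => if_neg fun hsum => hab ?_
      have h1 : b ∣ (χ t - 1) * a := by
        have : (χ t - 1) * a = s - ∑ i, χ (τ i) * b := by linear_combination hsum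
        rw [this]
        exact dvd_sub hs (Finset.dvd_sum fun i _ => dvd_mul_left _ _)
      exact ((h.isUnit t ht).dvd_mul_left).1 h1
    · exact fun hne => absurd (Finset.mem_univ _) hne
  · rw [Finset.filter_eq_empty_iff.2 (fun τ _ hτ => hs ?_), Finset.sum_empty, smul_zero]
    rw [← hτ]
    exact Finset.dvd_sum fun i _ => dvd_mul_left _ _

/-- The values `ζ (χ t * b)` are distinct for distinct `t`, so a Lagrange polynomial of degree below
`q` isolates the term `t = 1`. -/
theorem exists_eq_sum_twistedTrace (hχ : ∀ h, h ≠ 1 → IsUnit (χ h - 1)) {ζ : AddChar (ZMod n) K}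
    (hζ : Function.Injective ζ) (ρ : H →* Module.End K V) {b : ZMod n} (hb : b ≠ 0) :
    ∃ r : ℕ → K, ∀ x, x = ∑ j ∈ Finset.range (Fintype.card H), r j • twistedTrace χ ζ ρ b j x := by
  classical
  have hinj : Set.InjOn (fun t : H => ζ (χ t * b)) (Finset.univ : Finset H) := by
    intro s _ t _ hst
    have h1 : χ s * b = χ t * b := hζ hst
    by_contra hne
    have h2 : s⁻¹ * t ≠ 1 := fun h => hne (inv_mul_eq_one.1 h)
    have h3 : χ s⁻¹ * χ s = 1 := by rw [← map_mul, inv_mul_cancel, map_one]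
    refine hb ((hχ _ h2).mul_right_eq_zero.1 ?_)
    rw [map_mul]
    linear_combination χ s⁻¹ * (-h1) + b * h3
  let P := Lagrange.basis Finset.univ (fun t : H => ζ (χ t * b)) 1
  have hdeg : P.natDegree < Fintype.card H := by
    have h1 : P.degree = ((Fintype.card H - 1 : ℕ) : WithBot ℕ) :=
      Lagrange.degree_basis hinj (Finset.mem_univ _)
    rw [Polynomial.natDegree_eq_of_degree_eq_some h1]
    have : 0 < Fintype.card H := Fintype.card_pos
    omega
  refine ⟨P.coeff, fun x => ?_⟩
  simp only [twistedTrace, Finset.smul_sum, smul_smul]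
  rw [Finset.sum_comm]
  simp only [← Finset.sum_smul]
  have heval : ∀ t : H, ∑ j ∈ Finset.range (Fintype.card H), P.coeff j * ζ (χ t * b) ^ j
      = if t = 1 then 1 else 0 := by
    intro t
    rw [← Polynomial.eval_eq_sum_range' hdeg]
    split_ifs with ht
    · subst ht
      exact Lagrange.eval_basis_self hinj (Finset.mem_univ _)
    · exact Lagrange.eval_basis_of_ne (v := fun t : H => ζ (χ t * b)) (Ne.symm ht) (Finset.mem_univ t)
  simp [heval, conjOp_one]

end FrobeniusAction

/-! ### From solvability to nilpotency. -/

section Nilpotency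

attribute [local instance] LieRing.ofAssociativeRing

variable {K V : Type*} [Field K] [AddCommGroup V] [Module K V]

theorem exists_lt_length_filter {α β : Type*} [DecidableEq β] (f : α → β) (D : Finset β) (N : ℕ)
    (l : List α) (hl : ∀ x ∈ l, f x ∈ D) (h : D.card * N < l.length) :
    ∃ b ∈ D, N < (l.filter fun x => f x = b).length := by
  by_contra! hcon
  have h1 : l.length = ∑ b ∈ D, (l.filter fun x => f x = b).length := by
    clear hcon h
    induction l with
    | nil => simp
    | cons x l ih =>
      have h2 : ∀ b, ((x :: l).filter fun x => f x = b).length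
          = (if f x = b then 1 else 0) + (l.filter fun x => f x = b).length := by
        intro b
        by_cases hb : f x = b
        · simp [hb, add_comm]
        · simp [hb]
      simp only [h2, Finset.sum_add_distrib, Finset.sum_ite_eq, hl x List.mem_cons_self, if_true]
      rw [List.length_cons, ih fun y hy => hl y (List.mem_cons_of_mem _ hy), add_comm]
  have := Finset.sum_le_card_nsmul D _ N hcon
  rw [← h1, smul_eq_mul] at this
  omega

/-- Products of elements of `span S` map `p` into `Q` if products of elements of `S` do. -/
theorem prod_apply_mem_of_span {S : Set (Module.End K V)} {p : V} {Q : Submodule K V} {m : ℕ}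
    (hS : ∀ l : List (Module.End K V), l.length = m → (∀ x ∈ l, x ∈ S) → l.prod p ∈ Q)
    (l : List (Module.End K V)) (hlen : l.length = m) (hl : ∀ x ∈ l, x ∈ Submodule.span K S) :
    l.prod p ∈ Q := by
  suffices H : ∀ l' : List (Module.End K V), l'.length + l.length = m → (∀ x ∈ l', x ∈ S) →
      (l' ++ l).prod p ∈ Q from by simpa using H [] (by simpa using hlen) (by simp)
  clear hlen
  induction l with
  | nil => intro l' hlen hl'; simpa using hS l' (by simpa using hlen) hl'
  | cons x l ih =>
    intro l' hlen hl'
    have hx := hl x List.mem_cons_self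
    induction hx using Submodule.span_induction with
    | mem x hx =>
      have := ih (fun y hy => hl y (List.mem_cons_of_mem _ hy)) (l' ++ [x])
        (by simp only [List.length_append, List.length_cons, List.length_nil] at hlen ⊢; omega)
        (by
          intro y hy
          rcases List.mem_append.1 hy with hy | hy
          · exact hl' y hy
          · rw [List.mem_singleton.1 hy]; exact hx)
      simpa using this
    | zero => simp
    | add x y hx hy h h' =>
      have h1 := h (List.forall_mem_cons.2 ⟨hx, fun z hz => hl z (List.mem_cons_of_mem _ hz)⟩) hlen
      have h2 := h' (List.forall_mem_cons.2 ⟨hy, fun z hz => hl z (List.mem_cons_of_mem _ hz)⟩) hlen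
      simpa [add_mul, mul_add] using add_mem h1 h2
    | smul t x hx h =>
      have h1 := h (List.forall_mem_cons.2 ⟨hx, fun z hz => hl z (List.mem_cons_of_mem _ hz)⟩) hlen
      simpa using Submodule.smul_mem _ t h1

/-- Commuting operators modulo `Q` may be permuted. -/
theorem prod_apply_sub_prod_apply_mem {W : Set (Module.End K V)} {P Q : Submodule K V}
    (hP : ∀ x ∈ W, ∀ u ∈ P, x u ∈ P) (hQ : ∀ x ∈ W, ∀ u ∈ Q, x u ∈ Q)
    (hPQ : ∀ x ∈ W, ∀ y ∈ W, ∀ u ∈ P, x (y u) - y (x u) ∈ Q)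
    {l l' : List (Module.End K V)} (hll' : l.Perm l') (hl : ∀ x ∈ l, x ∈ W) {p : V} (hp : p ∈ P) :
    l.prod p - l'.prod p ∈ Q := by
  induction hll' with
  | nil => simp
  | cons x _ ih =>
    rw [List.forall_mem_cons] at hl
    have := hQ x hl.1 _ (ih hl.2)
    simpa using this
  | swap x y l =>
    rw [List.forall_mem_cons, List.forall_mem_cons] at hl
    have hmem : ∀ l : List (Module.End K V), (∀ x ∈ l, x ∈ W) → l.prod p ∈ P := by
      intro l hl
      induction l with
      | nil => simpa using hp
      | cons x l ih =>
        rw [List.forall_mem_cons] at hl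
        simpa using hP x hl.1 _ (ih hl.2)
    simpa using hPQ y hl.1 x hl.2.1 _ (hmem l hl.2.2)
  | trans h₁ _ ih₁ ih₂ =>
    have := add_mem (ih₁ hl) (ih₂ fun x hx => hl x (h₁.mem_iff.2 hx))
    simpa using this

variable {n : ℕ}

/-- The family `g` acts on `P` and on `Q`, and its elements commute on `P` modulo `Q`. -/
structure IsAbelianSection (g : ZMod n → Submodule K (Module.End K V)) (P Q : Submodule K V) :
    Prop where
  stable : IsStableFor g P
  stable_sub : IsStableFor g Q
  lie_apply_mem : ∀ a b, ∀ x ∈ g a, ∀ y ∈ g b, ∀ u ∈ P, ⁅x, y⁆ u ∈ Q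

theorem IsAbelianSection.prod_apply_sub_mem {g : ZMod n → Submodule K (Module.End K V)}
    {P Q : Submodule K V} (hs : IsAbelianSection g P Q) {l l' : List (Module.End K V)}
    (hll' : l.Perm l') (hl : ∀ x ∈ l, x ∈ ⨆ b, g b) {p : V} (hp : p ∈ P) :
    l.prod p - l'.prod p ∈ Q := by
  have hstab : ∀ {R : Submodule K V}, IsStableFor g R → ∀ x ∈ ⨆ b, g b, ∀ u ∈ R, x u ∈ R := by
    intro R hR x hx u hu
    refine Submodule.iSup_induction g (motive := fun x => x u ∈ R) hx (fun i x hx => hR i x hx u hu)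
      (zero_mem _) fun x y hx hy => ?_
    rw [LinearMap.add_apply]
    exact add_mem hx hy
  refine prod_apply_sub_prod_apply_mem (W := {x | x ∈ ⨆ b, g b}) (hstab hs.stable)
    (hstab hs.stable_sub) ?_ hll' hl hp
  intro x hx y hy u hu
  refine Submodule.iSup_induction g (motive := fun x => x (y u) - y (x u) ∈ Q) hx
    (fun i x hx => ?_) (by simp) fun x x' h h' => ?_
  · refine Submodule.iSup_induction g (motive := fun y => x (y u) - y (x u) ∈ Q) hy
      (fun j y hy => hs.lie_apply_mem i j x hx y hy u hu) (by simp) fun y y' h h' => ?_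
    have := add_mem h h'
    simp only [LinearMap.add_apply, map_add]
    rwa [add_sub_add_comm]
  · have := add_mem h h'
    simp only [LinearMap.add_apply, map_add]
    rwa [add_sub_add_comm]

theorem IsAbelianSection.wordOp_mem_of_perm {g : ZMod n → Submodule K (Module.End K V)}
    {P Q : Submodule K V} (hs : IsAbelianSection g P Q) {l l' : List (ZMod n × Module.End K V)}
    (hll' : l.Perm l') (hl : IsWord g l) {p : V} (hp : p ∈ P) (h : wordOp l' p ∈ Q) :
    wordOp l p ∈ Q := by
  have := hs.prod_apply_sub_mem (hll'.map Prod.snd) (by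
    intro x hx
    obtain ⟨r, hr, rfl⟩ := List.mem_map.1 hx
    exact Submodule.mem_iSup_of_mem _ (hl r hr)) hp
  change wordOp l p - wordOp l' p ∈ Q at this
  simpa using add_mem this h

variable {H : Type*} [Group H] [Fintype H] {χ : H →* ZMod n} {ρ : H →* Module.End K V} {c : ℕ}
  {v : ZMod n → Submodule K V} {g : ZMod n → Submodule K (Module.End K V)}

theorem IsFrobeniusAction.mono (h : IsFrobeniusAction χ ρ c v g)
    {g' : ZMod n → Submodule K (Module.End K V)} (hle : ∀ e, g' e ≤ g e) (hg' : IsLieGraded g')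
    (hconj : IsConjStable χ ρ g') : IsFrobeniusAction χ ρ c v g' where
  graded := ⟨hg', fun a b x hx => h.graded.act a b x (hle b hx),
    le_bot_iff.1 (h.graded.zero ▸ hle 0)⟩
  isUnit := h.isUnit
  independent := h.independent
  zero := h.zero
  rho_mem := h.rho_mem
  conj := hconj
  trace x hx := h.trace x fun i => (hx i).imp fun b hb => hle b hb

/-- Each letter is a combination of `q` kinds of twisted traces. Among more than `q * c` letters
some kind occurs more than `c` times, and `c` of these, moved to act first, kill `p`. -/
theorem IsFrobeniusAction.prod_apply_mem_of_not_dvd [NeZero n] (h : IsFrobeniusAction χ ρ c v g)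
    {ζ : AddChar (ZMod n) K} (hζ : Function.Injective ζ) {P Q : Submodule K V}
    (hs : IsAbelianSection g P Q) {a b : ZMod n} (hb : b ≠ 0) (hab : ¬ b ∣ a) {p : V}
    (hp : p ∈ P) (hpa : p ∈ v a) (l : List (Module.End K V)) (hl : ∀ x ∈ l, x ∈ g b)
    (hlen : Fintype.card H * c < l.length) : l.prod p ∈ Q := by
  classical
  obtain ⟨r, hr⟩ := exists_eq_sum_twistedTrace h.isUnit hζ ρ hb
  set X := twistedTrace χ ζ ρ b with hX
  have hXg : ∀ j, ∀ x ∈ g b, X j x ∈ ⨆ b, g b := fun j x hx =>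
    sum_mem fun t _ => Submodule.smul_mem _ _ (Submodule.mem_iSup_of_mem _ (h.conj t b x hx))
  refine prod_apply_mem_of_span (S := {y | ∃ j < Fintype.card H, ∃ x ∈ g b, y = X j x}) ?_ l rfl ?_
  · intro l' hlen' hl'
    choose! j hj x hx hjx using hl'
    obtain ⟨j₀, -, hj₀⟩ := exists_lt_length_filter j (Finset.range (Fintype.card H)) c l'
      (fun y hy => Finset.mem_range.2 (hj y hy)) (by rw [Finset.card_range]; omega)
    set l₁ := l'.filter (fun y => j y = j₀) with hl₁
    have hperm : l'.Perm ((l'.filter (fun y => ¬ j y = j₀) ++ l₁.take (l₁.length - c))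
        ++ l₁.drop (l₁.length - c)) := by
      rw [List.append_assoc, List.take_append_drop]
      have := List.filter_append_perm (fun y => j y = j₀) l'
      refine this.symm.trans (List.perm_append_comm.trans ?_)
      simp [hl₁]
    have hsub := hs.prod_apply_sub_mem hperm (fun y hy => by
      rw [hjx y hy]; exact hXg _ _ (hx y hy)) hp
    have hzero : (l₁.drop (l₁.length - c)).prod p = 0 := by
      have hmem : ∀ y ∈ l₁.drop (l₁.length - c), y ∈ l' ∧ j y = j₀ := fun y hy => by
        simpa [hl₁] using List.mem_of_mem_drop hy
      have := h.prod_twistedTrace_apply ζ hab j₀ (l := (l₁.drop (l₁.length - c)).map x)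
        (by rw [List.length_map, List.length_drop]; omega)
        (by
          intro y hy
          obtain ⟨z, hz, rfl⟩ := List.mem_map.1 hy
          exact hx z (hmem z hz).1) hpa
      rw [List.map_map] at this
      have hid : (l₁.drop (l₁.length - c)).map (X j₀ ∘ x) = l₁.drop (l₁.length - c) := by
        conv_rhs => rw [← List.map_id (l₁.drop (l₁.length - c))]
        refine List.map_congr_left fun y hy => ?_
        have h1 := hmem y hy
        rw [Function.comp_apply, ← h1.2, ← hjx y h1.1, id]
      rwa [← hX, hid] at this
    rw [List.prod_append, Module.End.mul_apply, hzero, map_zero, sub_zero] at hsub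
    exact hsub
  · intro y hy
    rw [hr y]
    exact sum_mem fun j hj => Submodule.smul_mem _ _ (Submodule.subset_span
      ⟨j, Finset.mem_range.1 hj, y, hl y hy, rfl⟩)

def engelBound (q c : ℕ) : ℕ := powerBound q c + q * c + 1

/-- Large order of `b` is settled by selectivity with target `⊥`. For small order, either `b ∤ a`
and twisted traces apply, or adding `b` repeatedly to `a` reaches degree 0. -/
theorem IsFrobeniusAction.wordOp_mem_of_degree_eq [NeZero n] (h : IsFrobeniusAction χ ρ c v g)
    {ζ : AddChar (ZMod n) K} (hζ : Function.Injective ζ) {P Q : Submodule K V}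
    (hs : IsAbelianSection g P Q) {a b : ZMod n} {p : V}
    (hp : p ∈ P) (hpa : p ∈ v a) {l : List (ZMod n × Module.End K V)} (hl : IsWord g l)
    (hlb : ∀ r ∈ l, r.1 = b) (hlen : engelBound (Fintype.card H) c ≤ l.length) :
    wordOp l p ∈ Q := by
  unfold engelBound at hlen
  have hbot : IsStableFor g (⊥ : Submodule K V) := by
    intro i x _ u hu
    rw [Submodule.mem_bot] at hu ⊢
    rw [hu, map_zero]
  rcases le_total (powerBound (Fintype.card H) c) (addOrderOf b) with hle | hle
  · have := wordOp_mem_of_powerBound_le h.isUnit h.graded hbot h.isSelective hle hl hlb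
      (by omega) hpa
    rw [Submodule.mem_bot] at this
    rw [this]; exact zero_mem _
  · by_cases hab : b ∣ a
    · obtain ⟨k, rfl⟩ := hab
      -- Fewer than `addOrderOf b` letters carry degree `a = b * k` to degree 0, where the component
      -- is trivial.
      set j := (-k).val % addOrderOf b with hj
      have hjb : j • b + b * k = 0 := by
        rw [hj, mod_addOrderOf_nsmul, nsmul_eq_mul, ZMod.natCast_zmod_val]
        ring
      have hjlt : j < addOrderOf b := Nat.mod_lt _ (addOrderOf_pos b)
      have hsplit := List.take_append_drop (l.length - j) l
      rw [← hsplit] at hl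
      have hw := isWord_append.1 hl
      have hmem := h.graded.wordOp_mem hw.2 hpa
      rw [wordDegree_eq_nsmul (b := b) (fun r hr => hlb r (List.mem_of_mem_drop hr)),
        List.length_drop, show l.length - (l.length - j) = j by omega, hjb, h.zero,
        Submodule.mem_bot] at hmem
      rw [← hsplit, wordOp_append, Module.End.mul_apply, hmem, map_zero]
      exact zero_mem _
    · by_cases hb : b = 0
      · obtain ⟨r, l', rfl⟩ := List.exists_cons_of_length_pos (l := l) (by omega)
        have h0 : r.2 ∈ g 0 := by
          have := hl r List.mem_cons_self
          rwa [hlb r List.mem_cons_self, hb] at this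
        rw [h.graded.zero, Submodule.mem_bot] at h0
        rw [wordOp_cons, h0, zero_mul]
        exact zero_mem _
      · refine h.prod_apply_mem_of_not_dvd hζ hs hb hab hp hpa _ ?_ (by
          rw [List.length_map]; omega)
        intro x hx
        obtain ⟨r, hr, rfl⟩ := List.mem_map.1 hx
        exact hlb r hr ▸ hl r hr

def abelianBound (q c : ℕ) : ℕ := c + q ^ (c + 1) * engelBound q c + 1

/-- Letters independent with `a` are collected greedily at the right end. With `c` of them
selectivity applies; if the process stops earlier, the other letters have at most `q ^ (c + 1)`
degrees and one degree repeats often enough for the Engel-type bound. -/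
theorem IsFrobeniusAction.wordOp_mem_of_isAbelianSection [NeZero n]
    (h : IsFrobeniusAction χ ρ c v g)
    {ζ : AddChar (ZMod n) K} (hζ : Function.Injective ζ) {P Q : Submodule K V}
    (hs : IsAbelianSection g P Q) {a : ZMod n} {p : V}
    (hp : p ∈ P) (hpa : p ∈ v a) {l : List (ZMod n × Module.End K V)} (hl : IsWord g l)
    (hlen : abelianBound (Fintype.card H) c ≤ l.length) :
    wordOp l p ∈ Q := by
  classical
  unfold abelianBound at hlen
  by_cases ha : a = 0
  · rw [ha, h.zero, Submodule.mem_bot] at hpa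
    rw [hpa, map_zero]
    exact zero_mem _
  have key : ∀ i ≤ c, wordOp l p ∈ Q ∨ ∃ l₁ l₂, l.Perm (l₁ ++ l₂) ∧ l₂.length = i ∧
      IndependentDegrees χ (a ::ₘ (l₂.map Prod.fst : List (ZMod n))) := by
    intro i
    induction i with
    | zero =>
      intro _
      exact Or.inr ⟨l, [], by simp, rfl, by
        simpa using independentDegrees_singleton h.isUnit ha⟩
    | succ i ih =>
      intro hi
      rcases ih (by omega) with hmem | ⟨l₁, l₂, hperm, hlen₂, hind⟩
      · exact Or.inl hmem
      obtain ⟨D, hD, hDj⟩ := exists_finset_not_independentDegrees_cons h.isUnit hind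
      rw [Multiset.card_cons, Multiset.coe_card, List.length_map, hlen₂] at hD
      have hw := isWord_append.1 (hl.perm hperm)
      by_cases hl₁ : ∀ r ∈ l₁, r.1 ∈ D
      · left
        have hlen' := hperm.length_eq
        rw [List.length_append] at hlen'
        have hDc : D.card * engelBound (Fintype.card H) c
            ≤ Fintype.card H ^ (c + 1) * engelBound (Fintype.card H) c :=
          Nat.mul_le_mul_right _ (hD.trans (Nat.pow_le_pow_right Fintype.card_pos (by omega)))
        obtain ⟨b, -, hb⟩ := exists_lt_length_filter Prod.fst D
          (engelBound (Fintype.card H) c) l₁ hl₁ (by omega)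
        have hperm₁ := filter_ne_append_filter_eq_perm b l₁
        have hw₁ := isWord_append.1 (hw.1.perm hperm₁.symm)
        have hperm' : l.Perm (l₂ ++ l₁.filter (fun r => r.1 ≠ b)
            ++ l₁.filter (fun r => r.1 = b)) := by
          rw [List.append_assoc]
          exact hperm.trans (List.perm_append_comm.trans (hperm₁.symm.append_left _))
        refine hs.wordOp_mem_of_perm hperm' hl hp ?_
        rw [wordOp_append]
        refine hs.stable_sub.wordOp_mem (isWord_append.2 ⟨hw.2, hw₁.1⟩) ?_
        exact h.wordOp_mem_of_degree_eq hζ hs hp hpa hw₁.2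
          (fun r hr => by simpa using (List.mem_filter.1 hr).2) hb.le
      · right
        push Not at hl₁
        obtain ⟨r, hr, hrD⟩ := hl₁
        obtain ⟨m₁, m₂, rfl⟩ := List.append_of_mem hr
        refine ⟨m₁ ++ m₂, r :: l₂, hperm.trans ?_, by simp [hlen₂], ?_⟩
        · refine (List.perm_middle.append_right l₂).trans ?_
          exact List.perm_middle.symm
        · have := hDj r.1 hrD
          rw [Multiset.cons_swap] at this
          simpa using this
  rcases key c le_rfl with hmem | ⟨l₁, l₂, hperm, hlen₂, hind⟩
  · exact hmem
  · refine hs.wordOp_mem_of_perm hperm hl hp ?_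
    have := h.isSelective l₂ (isWord_append.1 (hl.perm hperm)).2 hlen₂ a p hpa hind
    rw [Submodule.mem_bot] at this
    rw [wordOp_append, Module.End.mul_apply, this, map_zero]
    exact zero_mem _

/-- The homogeneous components of the iterated products of the module with `g`. -/
def actionSeries (v : ZMod n → Submodule K V) (g : ZMod n → Submodule K (Module.End K V)) :
    ℕ → ZMod n → Submodule K V
  | 0 => v
  | i + 1 => fun a => Submodule.span K
      {t | ∃ b a', b + a' = a ∧ ∃ x ∈ g b, ∃ p ∈ actionSeries v g i a', t = x p}

theorem actionSeries_le (h : IsGradedAction v g) (i : ℕ) (a : ZMod n) :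
    actionSeries v g i a ≤ v a := by
  induction i generalizing a with
  | zero => exact le_rfl
  | succ i ih =>
    refine Submodule.span_le.2 ?_
    rintro t ⟨b, a', rfl, x, hx, p, hp, rfl⟩
    exact h.act a' b x hx p (ih a' hp)

theorem apply_mem_actionSeries (h : IsGradedAction v g) (i : ℕ) {a b : ZMod n}
    {x : Module.End K V} (hx : x ∈ g b) {p : V} (hp : p ∈ actionSeries v (derivedFamily g) i a) :
    x p ∈ actionSeries v (derivedFamily g) i (b + a) := by
  induction i generalizing a b x p with
  | zero => exact h.act a b x hx p hp
  | succ i ih =>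
    induction hp using Submodule.span_induction with
    | zero => rw [map_zero]; exact zero_mem _
    | add _ _ _ _ h h' => rw [map_add]; exact add_mem h h'
    | smul t _ _ h => rw [map_smul]; exact Submodule.smul_mem _ _ h
    | mem t ht =>
      obtain ⟨b', a', rfl, y, hy, p, hp, rfl⟩ := ht
      -- Commuting `x` past `y` leaves a bracket which again lies in the derived family.
      have h1 : x (y p) = y (x p) + ⁅x, y⁆ p := by
        simp [Ring.lie_def]
      rw [h1]
      refine add_mem (Submodule.subset_span ⟨b', b + a', by ring, y, hy, x p, ih hx hp, rfl⟩)
        (Submodule.subset_span ⟨b + b', a', by ring, ⁅x, y⁆, ?_, p, hp, rfl⟩)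
      exact lie_mem_derivedFamily hx (derivedFamily_le h.lie _ hy)

theorem isAbelianSection_actionSeries (h : IsGradedAction v g) (i : ℕ) :
    IsAbelianSection g (⨆ a, actionSeries v (derivedFamily g) i a)
      (⨆ a, actionSeries v (derivedFamily g) (i + 1) a) := by
  have hstab : ∀ i, IsStableFor g (⨆ a, actionSeries v (derivedFamily g) i a) := by
    intro i b x hx u hu
    refine Submodule.iSup_induction _ (motive := fun u => x u ∈ _) hu (fun a p hp =>
      Submodule.mem_iSup_of_mem _ (apply_mem_actionSeries h i hx hp)) ?_ fun p p' hp hp' => ?_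
    · rw [map_zero]; exact zero_mem _
    · rw [map_add]; exact add_mem hp hp'
  refine ⟨hstab i, hstab (i + 1), fun a b x hx y hy u hu => ?_⟩
  refine Submodule.iSup_induction _ (motive := fun u => ⁅x, y⁆ u ∈ _) hu (fun a' p hp =>
      Submodule.mem_iSup_of_mem (a + b + a') (Submodule.subset_span
        ⟨a + b, a', rfl, _, lie_mem_derivedFamily hx hy, p, hp, rfl⟩)) ?_ fun p p' hp hp' => ?_
  · rw [map_zero]; exact zero_mem _
  · rw [map_add]; exact add_mem hp hp'

theorem actionSeries_le_span (i : ℕ) (a : ZMod n) :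
    actionSeries v g i a ≤ Submodule.span K
      {t | ∃ l, IsWord g l ∧ l.length = i ∧ ∃ u, t = wordOp l u} := by
  induction i generalizing a with
  | zero => exact fun u _ => Submodule.subset_span ⟨[], isWord_nil, rfl, u, rfl⟩
  | succ i ih =>
    refine Submodule.span_le.2 ?_
    rintro t ⟨b, a', rfl, x, hx, p, hp, rfl⟩
    have := ih a' hp
    clear hp
    induction this using Submodule.span_induction with
    | zero => rw [map_zero]; exact zero_mem _
    | add _ _ _ _ h h' => rw [map_add]; exact add_mem h h'
    | smul t _ _ h => rw [map_smul]; exact Submodule.smul_mem _ _ h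
    | mem t ht =>
      obtain ⟨l, hl, hlen, u, rfl⟩ := ht
      exact Submodule.subset_span
        ⟨(b, x) :: l, isWord_cons.2 ⟨hx, hl⟩, by simp [hlen], u, by simp⟩

/-- Words of length `N` in the derived family vanish, hence so do long words in the family. -/
theorem IsFrobeniusAction.wordOp_eq_zero_of_derivedFamily [NeZero n]
    (h : IsFrobeniusAction χ ρ c v g) {ζ : AddChar (ZMod n) K} (hζ : Function.Injective ζ)
    (hv : ⨆ a, v a = ⊤) {N : ℕ}
    (hN : ∀ l, IsWord (derivedFamily g) l → l.length = N → wordOp l = (0 : Module.End K V))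
    {l : List (ZMod n × Module.End K V)} (hl : IsWord g l)
    (hlen : l.length = N * abelianBound (Fintype.card H) c) : wordOp l = 0 := by
  -- Brackets of `g` lie in the derived family, so `g` acts commutatively on each factor of the
  -- series of the derived family. Each block of `abelianBound` letters descends one step.
  have key : ∀ i l, IsWord g l → l.length = i * abelianBound (Fintype.card H) c →
      ∀ u, wordOp l u ∈ ⨆ a, actionSeries v (derivedFamily g) i a := by
    intro i
    induction i with
    | zero =>
      intro l hl hlen u
      have : ⨆ a, actionSeries v (derivedFamily g) 0 a = ⊤ := hv
      rw [this]; trivial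
    | succ i ih =>
      intro l hl hlen u
      have hsplit := List.take_append_drop (abelianBound (Fintype.card H) c) l
      rw [← hsplit] at hl ⊢
      have hw := isWord_append.1 hl
      rw [add_mul, one_mul] at hlen
      have hu := ih _ hw.2 (by rw [List.length_drop]; omega) u
      rw [wordOp_append, Module.End.mul_apply]
      have hs := isAbelianSection_actionSeries h.graded i
      refine Submodule.iSup_induction' _
        (motive := fun t _ => wordOp (l.take (abelianBound (Fintype.card H) c)) t ∈ _)
        (fun a p hp => ?_) ?_ (fun p p' _ _ hp hp' => ?_) hu
      · refine h.wordOp_mem_of_isAbelianSection hζ hs (Submodule.mem_iSup_of_mem a hp)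
          (a := a) ?_ hw.1 (by rw [List.length_take]; omega)
        have hle : ∀ i a, actionSeries v (derivedFamily g) i a ≤ v a := fun i a =>
          actionSeries_le ⟨derivedFamily_isLieGraded h.graded.lie, fun a b x hx =>
            h.graded.act a b x (derivedFamily_le h.graded.lie b hx),
            le_bot_iff.1 (h.graded.zero ▸ derivedFamily_le h.graded.lie 0)⟩ i a
        exact hle i a hp
      · rw [map_zero]; exact zero_mem _
      · rw [map_add]; exact add_mem hp hp'
  ext u
  have h1 := key N l hl hlen u
  have h2 : ⨆ a, actionSeries v (derivedFamily g) N a ≤ ⊥ := by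
    refine iSup_le fun a => (actionSeries_le_span N a).trans (Submodule.span_le.2 ?_)
    rintro t ⟨l, hl, hlen, u, rfl⟩
    simp [hN l hl hlen]
  simpa using h2 h1

/-- The derived family inherits every hypothesis and has derived length one less; each step
multiplies the word length by `abelianBound`. -/
theorem IsFrobeniusAction.wordOp_eq_zero_of_solvable [NeZero n] (k : ℕ)
    (h : IsFrobeniusAction χ ρ c v g) {ζ : AddChar (ZMod n) K} (hζ : Function.Injective ζ)
    (hv : ⨆ a, v a = ⊤) (hk : ∀ e, derivedFamily^[k] g e = ⊥)
    {l : List (ZMod n × Module.End K V)} (hl : IsWord g l)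
    (hlen : l.length = abelianBound (Fintype.card H) c ^ k) : wordOp l = 0 := by
  induction k generalizing g l with
  | zero =>
    obtain ⟨r, rfl⟩ := List.length_eq_one_iff.1 hlen
    have := hl r List.mem_cons_self
    rw [show g r.1 = ⊥ from hk r.1, Submodule.mem_bot] at this
    simp [this]
  | succ k ih =>
    refine h.wordOp_eq_zero_of_derivedFamily hζ hv (N := abelianBound (Fintype.card H) c ^ k)
      (fun l hl hlen => ?_) hl (by rw [hlen, pow_succ])
    exact ih (h.mono (derivedFamily_le h.graded.lie) (derivedFamily_isLieGraded h.graded.lie)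
      h.conj.derivedFamily) hk hl hlen

def nilpotencyBound (q c : ℕ) : ℕ := abelianBound q c ^ solvabilityBound q c

theorem IsFrobeniusAction.wordOp_eq_zero [NeZero n] (h : IsFrobeniusAction χ ρ c v g)
    {ζ : AddChar (ZMod n) K} (hζ : Function.Injective ζ) (hv : ⨆ a, v a = ⊤)
    {l : List (ZMod n × Module.End K V)} (hl : IsWord g l)
    (hlen : l.length = nilpotencyBound (Fintype.card H) c) : wordOp l = 0 := by
  refine h.wordOp_eq_zero_of_solvable _ hζ hv (fun e => ?_) hl hlen
  refine (Submodule.eq_bot_iff _).2 fun x hx => ?_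
  have hbot : IsStableFor g (⊥ : Submodule K V) := by
    intro i x _ u hu
    rw [Submodule.mem_bot] at hu ⊢
    rw [hu, map_zero]
  ext u
  have hu : u ∈ ⨆ a, v a := hv ▸ Submodule.mem_top
  refine Submodule.iSup_induction v (motive := fun u => x u = 0) hu (fun a u hu => ?_) (map_zero x)
    fun u u' hu hu' => by rw [map_add, hu, hu', add_zero]
  have := iterate_derivedFamily_apply_mem h.isUnit h.graded c hbot h.zero.le h.isSelective hx hu
  simpa using this

end Nilpotency

/-! ### The grading by eigenspaces of the kernel generator. -/

section Eigenspaces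

attribute [local instance] LieRing.ofAssociativeRing

variable {K V : Type*} [Field K] [AddCommGroup V] [Module K V] {n : ℕ} [NeZero n]

theorem iSup_eigenspace_eq_top {ω : K} (hω : IsPrimitiveRoot ω n) (hn : (n : K) ≠ 0)
    {φ : Module.End K V} (hφ : φ ^ n = 1) :
    ⨆ a, φ.eigenspace (AddChar.zmodChar n hω.pow_eq_one a) = ⊤ := by
  classical
  set ζ := AddChar.zmodChar n hω.pow_eq_one with hζ
  refine Submodule.eq_top_iff'.2 fun u => ?_
  have hval : ∀ j : ZMod n, φ ^ (j + 1).val = φ * φ ^ j.val := by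
    intro j
    rw [← pow_succ', pow_eq_pow_mod _ hφ, pow_eq_pow_mod (j.val + 1) hφ, ZMod.val_add,
      Nat.mod_mod]
    congr 1
    rw [Nat.add_mod, Nat.add_mod j.val 1]
    congr 2
    rw [ZMod.val_one_eq_one_mod, Nat.mod_mod]
  -- Fourier inversion: the inner sum over `j` is `n` times the projection of `u` to the eigenspace
  -- of `ζ a`.
  have hu : (n : K)⁻¹ • ∑ a : ZMod n, ∑ j : ZMod n, ζ (a * (-j)) • (φ ^ j.val) u = u := by
    rw [Finset.sum_comm]
    simp only [← Finset.sum_smul]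
    have hsum : ∀ j : ZMod n, ∑ a, ζ (a * (-j)) = if j = 0 then (n : K) else 0 := by
      intro j
      rw [AddChar.sum_mulShift _ (AddChar.zmodChar_primitive_of_primitive_root n hω), ZMod.card]
      simp
    simp only [hsum, ite_smul, zero_smul, Finset.sum_ite_eq', Finset.mem_univ, if_true,
      ZMod.val_zero, pow_zero, Module.End.one_apply]
    rw [smul_smul, inv_mul_cancel₀ hn, one_smul]
  rw [← hu]
  refine Submodule.smul_mem _ _ (sum_mem fun a _ => Submodule.mem_iSup_of_mem a ?_)
  rw [Module.End.mem_eigenspace_iff, map_sum, Finset.smul_sum]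
  refine Fintype.sum_equiv (Equiv.addRight (1 : ZMod n)) _ _ fun j => ?_
  rw [Equiv.coe_addRight, hval, map_smul, smul_smul, ← AddChar.map_add_eq_mul,
    Module.End.mul_apply]
  congr 2
  ring

/-- A right Leibniz product, given by its right multiplications `R`, with a group of
automorphisms generated by an automorphism `φ` and the image of `ρ`, vanishes on long words. -/
theorem prod_rightMul_eq_zero {ω : K} (hω : IsPrimitiveRoot ω n) (hn : (n : K) ≠ 0)
    {H : Type*} [Group H] [Fintype H] {χ : H →* ZMod n} {ρ : H →* Module.End K V} {c : ℕ}
    (hχ : ∀ h, h ≠ 1 → IsUnit (χ h - 1)) {R : V →ₗ[K] Module.End K V}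
    (hR : ∀ x y, R (R y x) = R y * R x - R x * R y)
    {φ : Module.End K V} (hφ : φ ^ n = 1) (hφR : ∀ x u, φ (R x u) = R (φ x) (φ u))
    (hfix : ∀ u, φ u = u → u = 0)
    (hρR : ∀ h x u, ρ h (R x u) = R (ρ h x) (ρ h u))
    (hφρ : ∀ h, φ * ρ h = ρ h * φ ^ (χ h).val)
    (htr : ∀ x : Fin c → V, ∀ u,
      (List.ofFn fun i => R (∑ h, ρ h (x i))).prod (∑ h, ρ h u) = 0)
    (l : List V) (hl : l.length = nilpotencyBound (Fintype.card H) c) : (l.map R).prod = 0 := by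
  classical
  set ζ := AddChar.zmodChar n hω.pow_eq_one with hζdef
  have hζ : Function.Injective ζ := by
    intro a b hab
    rw [AddChar.zmodChar_apply, AddChar.zmodChar_apply] at hab
    exact ZMod.val_injective n (hω.pow_inj (ZMod.val_lt a) (ZMod.val_lt b) hab)
  let v : ZMod n → Submodule K V := fun a => φ.eigenspace (ζ a)
  have hv : ∀ a u, u ∈ v a ↔ φ u = ζ a • u := fun a u => Module.End.mem_eigenspace_iff
  have hact : ∀ a b x u, x ∈ v b → u ∈ v a → R x u ∈ v (b + a) := by
    intro a b x u hx hu
    rw [hv] at hx hu ⊢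
    rw [hφR, hx, hu, map_smul, map_smul, LinearMap.smul_apply, smul_smul, AddChar.map_add_eq_mul,
      mul_comm]
  have hv0 : v 0 = ⊥ := by
    refine (Submodule.eq_bot_iff _).2 fun u hu => hfix u ?_
    rw [hv, AddChar.map_zero_eq_one, one_smul] at hu
    exact hu
  have hpow : ∀ (m : ℕ) a u, u ∈ v a → (φ ^ m) u = ζ a ^ m • u := by
    intro m a u hu
    induction m with
    | zero => simp
    | succ m ih =>
      rw [pow_succ, Module.End.mul_apply, (hv a u).1 hu, map_smul, ih, smul_smul, pow_succ']
  have hρv : ∀ h a, ∀ u ∈ v a, ρ h u ∈ v (χ h * a) := by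
    intro h a u hu
    rw [hv, ← Module.End.mul_apply, hφρ, Module.End.mul_apply, hpow _ a u hu, map_smul,
      ← AddChar.map_nsmul_eq_pow, nsmul_eq_mul, ZMod.natCast_zmod_val]
  have hconj : ∀ h x, conjOp ρ h (R x) = R (ρ h x) := by
    intro h x
    ext u
    rw [conjOp, Module.End.mul_apply, Module.End.mul_apply, hρR, ← Module.End.mul_apply (ρ h),
      ← map_mul, mul_inv_cancel, map_one, Module.End.one_apply]
  let g : ZMod n → Submodule K (Module.End K V) := fun b => (v b).map R
  have hF : IsFrobeniusAction χ ρ c v g :=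
    { graded := by
        refine ⟨?_, ?_, ?_⟩
        · rintro a b _ ⟨x, hx, rfl⟩ _ ⟨y, hy, rfl⟩
          exact ⟨R x y, hact b a x y hx hy, by rw [hR, Ring.lie_def]⟩
        · rintro a b _ ⟨x, hx, rfl⟩ u hu
          exact hact a b x u hx hu
        · simp only [g, hv0, Submodule.map_bot]
      isUnit := hχ
      independent := (Module.End.eigenspaces_iSupIndep φ).comp hζ
      zero := hv0
      rho_mem := hρv
      conj := by
        rintro h b _ ⟨x, hx, rfl⟩
        exact ⟨ρ h x, hρv h b x hx, (hconj h x).symm⟩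
      trace := by
        intro x hx a u _
        choose b y hy hyx using hx
        obtain rfl : (fun i => R (y i)) = x := funext hyx
        simpa only [hconj, map_sum] using htr y u }
  have htop : ⨆ a, v a = ⊤ := iSup_eigenspace_eq_top hω hn hφ
  ext u
  -- The bound is known for homogeneous operators; multilinearity extends it to arbitrary right
  -- multiplications.
  have key := prod_apply_mem_of_span (S := {y | ∃ b, y ∈ g b}) (p := u) (Q := ⊥)
    (m := nilpotencyBound (Fintype.card H) c) (fun l hlen hl => by
      choose! d hd using hl
      have hw : IsWord g (l.map fun y => (d y, y)) := by
        intro r hr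
        obtain ⟨y, hy, rfl⟩ := List.mem_map.1 hr
        exact hd y hy
      have := hF.wordOp_eq_zero hζ htop hw (by rw [List.length_map, hlen])
      have hid : wordOp (l.map fun y => (d y, y)) = l.prod := by
        simp [wordOp, Function.comp_def]
      rw [← hid, this]
      exact zero_mem _) (l.map R) (by rw [List.length_map, hl]) (by
      intro y hy
      obtain ⟨x, -, rfl⟩ := List.mem_map.1 hy
      have hx : x ∈ ⨆ a, v a := htop ▸ Submodule.mem_top
      refine Submodule.iSup_induction v (motive := fun x => R x ∈ _) hx
        (fun b x hx => Submodule.subset_span ⟨b, x, hx, rfl⟩) ?_ fun x y hx hy => ?_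
      · rw [map_zero]; exact zero_mem _
      · rw [map_add]; exact add_mem hx hy)
  simpa using key

end Eigenspaces

/-! ### Passage to the algebraic closure. -/

section ScalarExtension

open TensorProduct

variable {K L : Type*} [Field K] [AddCommGroup L] [Module K L] {n : ℕ} [NeZero n]

theorem span_range_tensorProduct_mk (K' : Type*) [Field K'] [Algebra K K'] :
    Submodule.span K' (Set.range (TensorProduct.mk K K' L 1)) = ⊤ := by
  refine Submodule.eq_top_iff'.2 fun x => ?_
  induction x using TensorProduct.induction_on with
  | zero => exact zero_mem _
  | add x y hx hy => exact add_mem hx hy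
  | tmul a y =>
    have : a ⊗ₜ[K] y = a • (TensorProduct.mk K K' L 1 y) := by
      rw [TensorProduct.mk_apply, TensorProduct.smul_tmul', smul_eq_mul, mul_one]
    rw [this]
    exact Submodule.smul_mem _ _ (Submodule.subset_span ⟨y, rfl⟩)

theorem prod_rightMul_eq_zero_of_natCast_ne_zero (hn : (n : K) ≠ 0)
    {H : Type*} [Group H] [Fintype H] {χ : H →* ZMod n} {ρ : H →* Module.End K L} {c : ℕ}
    (hχ : ∀ h, h ≠ 1 → IsUnit (χ h - 1)) {R : L →ₗ[K] Module.End K L}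
    (hR : ∀ x y, R (R y x) = R y * R x - R x * R y)
    {φ : Module.End K L} (hφ : φ ^ n = 1) (hφR : ∀ x u, φ (R x u) = R (φ x) (φ u))
    (hfix : ∀ u, φ u = u → u = 0)
    (hρR : ∀ h x u, ρ h (R x u) = R (ρ h x) (ρ h u))
    (hφρ : ∀ h, φ * ρ h = ρ h * φ ^ (χ h).val)
    (htr : ∀ l : List L, l.length = c → ∀ u,
      (l.map fun x => R (∑ h, ρ h x)).prod (∑ h, ρ h u) = 0)
    (l : List L) (hl : l.length = nilpotencyBound (Fintype.card H) c) : (l.map R).prod = 0 := by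
  classical
  let K' := AlgebraicClosure K
  have hn' : (n : K') ≠ 0 := by
    rw [← map_natCast (algebraMap K K')]
    exact (map_ne_zero _).2 hn
  have : NeZero (n : K') := ⟨hn'⟩
  obtain ⟨ω, hω⟩ := HasEnoughRootsOfUnity.exists_primitiveRoot K' n
  let B := Module.End.baseChangeHom K K' L
  let ρ' : H →* Module.End K' (K' ⊗[K] L) :=
    (B : Module.End K L →* Module.End K' (K' ⊗[K] L)).comp ρ
  let R' : (K' ⊗[K] L) →ₗ[K'] Module.End K' (K' ⊗[K] L) := LinearMap.BilinMap.baseChange K' R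
  have hB : ∀ (f : Module.End K L) (a : K') (x : L), B f (a ⊗ₜ[K] x) = a ⊗ₜ[K] f x :=
    fun _ _ _ => rfl
  have hR' : ∀ (a b : K') (x y : L), R' (a ⊗ₜ[K] x) (b ⊗ₜ[K] y) = (a * b) ⊗ₜ[K] R x y :=
    fun _ _ _ _ => LinearMap.BilinMap.baseChange_tmul ..
  have hBR : ∀ f : Module.End K L, (∀ x u, f (R x u) = R (f x) (f u)) →
      ∀ x u, B f (R' x u) = R' (B f x) (B f u) := by
    intro f hf x u
    induction x using TensorProduct.induction_on with
    | zero => simp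
    | add x y hx hy => simp only [map_add, LinearMap.add_apply, hx, hy]
    | tmul a x =>
      induction u using TensorProduct.induction_on with
      | zero => simp
      | add x y hx hy => simp only [map_add, hx, hy]
      | tmul b u => rw [hR', hB, hB, hB, hR', hf]
  have hR'R' : ∀ x y, R' (R' y x) = R' y * R' x - R' x * R' y := by
    intro x y
    refine LinearMap.ext fun z => ?_
    rw [LinearMap.sub_apply, Module.End.mul_apply, Module.End.mul_apply]
    induction x using TensorProduct.induction_on with
    | zero => simp
    | add x x' hx hx' => simp only [map_add, LinearMap.add_apply, hx, hx']; abel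
    | tmul a x =>
      induction y using TensorProduct.induction_on with
      | zero => simp
      | add x x' hx hx' => simp only [map_add, LinearMap.add_apply, hx, hx']; abel
      | tmul b y =>
        induction z using TensorProduct.induction_on with
        | zero => simp
        | add x x' hx hx' => simp only [map_add, hx, hx']; abel
        | tmul d z =>
          rw [hR', hR', hR', hR', hR', hR', hR, LinearMap.sub_apply, TensorProduct.tmul_sub,
            Module.End.mul_apply, Module.End.mul_apply, mul_assoc, mul_left_comm a b d]
  have hprod : ∀ (l : List L) (u : L),
      (l.map fun x => R' (1 ⊗ₜ[K] x)).prod (1 ⊗ₜ[K] u) = 1 ⊗ₜ[K] (l.map R).prod u := by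
    intro l u
    induction l with
    | nil => simp
    | cons x l ih =>
      rw [List.map_cons, List.prod_cons, Module.End.mul_apply, ih, hR', one_mul]
      rfl
  have hmain := prod_rightMul_eq_zero (V := K' ⊗[K] L) (c := c) hω hn' hχ hR'R'
    (φ := B φ) (ρ := ρ') (by rw [← map_pow, hφ, map_one]) (hBR φ hφR)
    (by
      intro u hu
      -- Absence of fixed points is injectivity of `φ - 1`, which flatness preserves.
      have hinj : Function.Injective (φ - 1 : Module.End K L) := by
        refine (injective_iff_map_eq_zero _).2 fun u hu => hfix u ?_
        rwa [LinearMap.sub_apply, sub_eq_zero, Module.End.one_apply] at hu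
      have h1 : Function.Injective (B (φ - 1)) := by
        change Function.Injective (LinearMap.baseChange K' (φ - 1 : Module.End K L))
        rw [LinearMap.baseChange_eq_ltensor]
        exact Module.Flat.lTensor_preserves_injective_linearMap _ hinj
      refine h1 ?_
      rw [map_sub, map_one, LinearMap.sub_apply, hu, Module.End.one_apply, sub_self, map_zero])
    (fun h => hBR _ (hρR h))
    (fun h => by
      change B φ * B (ρ h) = B (ρ h) * (B φ) ^ (χ h).val
      rw [← map_mul, hφρ, map_mul, map_pow])
    (by
      intro x u
      have htr1 : ∀ y : L, ∑ h, ρ' h (1 ⊗ₜ[K] y) = 1 ⊗ₜ[K] ∑ h, ρ h y := by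
        intro y
        rw [TensorProduct.tmul_sum]
        rfl
      have hu : u ∈ Submodule.span K' (Set.range (TensorProduct.mk K K' L 1)) :=
        span_range_tensorProduct_mk (K := K) (L := L) K' ▸ Submodule.mem_top
      induction hu using Submodule.span_induction with
      | zero => simp
      | add u u' _ _ hu hu' => simp only [map_add, Finset.sum_add_distrib, hu, hu', add_zero]
      | smul t u _ hu => simp only [map_smul, ← Finset.smul_sum, hu, smul_zero]
      | mem u hu =>
        obtain ⟨u, rfl⟩ := hu
        -- The trace identity is multilinear, so it suffices to have it on pure tensors `1 ⊗ x`. No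
        -- description of all fixed points of `H` after extension is needed.
        have key := prod_apply_mem_of_span
          (S := {z | ∃ y : L, z = R' (1 ⊗ₜ[K] ∑ h, ρ h y)})
          (p := (1 : K') ⊗ₜ[K] ∑ h, ρ h u) (Q := ⊥) (m := c) (fun l hlen hl => by
            choose! y hy using hl
            have h1 : l = (l.map fun z => ∑ h, ρ h (y z)).map fun x => R' (1 ⊗ₜ[K] x) := by
              rw [List.map_map]
              conv_lhs => rw [← List.map_id l]
              exact List.map_congr_left fun z hz => hy z hz
            have h2 := htr (l.map y) (by rw [List.length_map, hlen]) u
            rw [List.map_map] at h2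
            rw [h1, hprod, List.map_map]
            rw [Function.comp_def] at h2 ⊢
            rw [h2, TensorProduct.tmul_zero]
            exact zero_mem _)
          (List.ofFn fun i => R' (∑ h, ρ' h (x i))) (by simp) (by
            intro z hz
            obtain ⟨i, rfl⟩ := List.mem_ofFn.1 hz
            have hx : x i ∈ Submodule.span K' (Set.range (TensorProduct.mk K K' L 1)) :=
              span_range_tensorProduct_mk (K := K) (L := L) K' ▸ Submodule.mem_top
            generalize x i = w at hx
            induction hx using Submodule.span_induction with
            | zero => simp
            | add u u' _ _ hu hu' =>
              simp only [map_add, Finset.sum_add_distrib]; exact add_mem hu hu'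
            | smul t u _ hu =>
              simp only [map_smul, ← Finset.smul_sum]; exact Submodule.smul_mem _ _ hu
            | mem u hu =>
              obtain ⟨u, rfl⟩ := hu
              exact Submodule.subset_span ⟨u, by rw [TensorProduct.mk_apply, htr1]⟩)
        rw [TensorProduct.mk_apply, htr1]
        simpa using key)
    (l.map fun x => (1 : K') ⊗ₜ[K] x) (by rw [List.length_map, hl])
  ext u
  have h1 := hprod l u
  rw [List.map_map, Function.comp_def] at hmain
  rw [hmain, LinearMap.zero_apply] at h1
  exact Module.Flat.tensorProduct_mk_injective K L K' (by
    rw [TensorProduct.mk_apply, ← h1, LinearMap.zero_apply, map_zero])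

end ScalarExtension

/-! ### The character of the complement and the removal of the characteristic. -/

section FrobeniusPair

theorem pow_mul_eq_mul_pow_mul {A : Type*} [Group A] {φ x : A} {k : ℕ} (h : φ * x = x * φ ^ k)
    (m : ℕ) : φ ^ m * x = x * φ ^ (k * m) := by
  induction m with
  | zero => simp
  | succ m ih =>
    rw [pow_succ, mul_assoc, h, ← mul_assoc, ih, mul_assoc, ← pow_add, mul_add, mul_one]

/-- The action of `H` on a normalized cyclic group as multiplication of exponents. -/
theorem exists_monoidHom_zmod_orderOf {A : Type*} [Group A] (φ : A) [NeZero (orderOf φ)]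
    (H : Subgroup A) (h : ∀ x ∈ H, ∃ k : ℕ, φ * x = x * φ ^ k) :
    ∃ χ : H →* ZMod (orderOf φ), ∀ x : H, φ * x = x * φ ^ (χ x).val := by
  have h' : ∀ x : H, ∃ k : ℕ, φ * x = x * φ ^ k := fun x => h x x.2
  choose k hk using h'
  refine ⟨⟨⟨fun x => (k x : ZMod (orderOf φ)), ?_⟩, fun x y => ?_⟩, fun x => ?_⟩
  · have h1 := hk 1
    rw [← Nat.cast_one, ZMod.natCast_eq_natCast_iff, ← pow_eq_pow_iff_modEq, pow_one]
    simpa using h1.symm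
  · rw [← Nat.cast_mul, ZMod.natCast_eq_natCast_iff, ← pow_eq_pow_iff_modEq]
    have h1 := hk (x * y)
    rw [Subgroup.coe_mul, ← mul_assoc, hk, mul_assoc, pow_mul_eq_mul_pow_mul (hk y), mul_assoc] at h1
    have h2 := mul_left_cancel (mul_left_cancel h1)
    rw [← h2, mul_comm]
  · change φ * x = x * φ ^ ((k x : ZMod (orderOf φ))).val
    rw [ZMod.val_natCast, ← pow_eq_pow_mod _ (pow_orderOf_eq_one φ), hk]

/-- If `a * (χ x - 1) = 0` with `a ≠ 0`, then `x` commutes with `φ ^ a ≠ 1`. In a finite ring a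
non-zero-divisor is a unit. -/
theorem isUnit_sub_one_of_fixedPointFree {A : Type*} [Group A] (φ : A) [NeZero (orderOf φ)]
    {H : Subgroup A} {χ : H →* ZMod (orderOf φ)} (hχ : ∀ x : H, φ * x = x * φ ^ (χ x).val)
    (hfree : ∀ m : ℕ, φ ^ m ≠ 1 → ∀ x ∈ H, x * φ ^ m = φ ^ m * x → x = 1) (x : H) (hx : x ≠ 1) :
    IsUnit (χ x - 1) := by
  rw [isUnit_iff_mem_nonZeroDivisors_of_finite, mem_nonZeroDivisors_iff_right]
  intro a ha
  by_contra ha0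
  refine hx (Subtype.ext (hfree a.val ?_ x x.2 ?_))
  · intro h1
    have := Nat.le_of_dvd (Nat.pos_of_ne_zero fun h => ha0 ((ZMod.val_eq_zero a).1 h))
      (orderOf_dvd_of_pow_eq_one h1)
    exact absurd (ZMod.val_lt a) (not_lt.2 this)
  · rw [pow_mul_eq_mul_pow_mul (hχ x), mul_right_inj, pow_eq_pow_iff_modEq, ← ZMod.natCast_eq_natCast_iff, Nat.cast_mul,
      ZMod.natCast_zmod_val, ZMod.natCast_zmod_val]
    linear_combination -ha

/-- If `φ` has finite order `n` and no fixed points then a power of `φ` with order prime to the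
characteristic has no fixed points either. -/
theorem exists_pow_fixedPointFree {K L : Type*} [Field K] [AddCommGroup L] [Module K L]
    (φ : Module.End K L) (hfix : ∀ u, φ u = u → u = 0) {n : ℕ} (hn : n ≠ 0) :
    ∃ e m, n = e * m ∧ (m : K) ≠ 0 ∧ ∀ u, (φ ^ e) u = u → u = 0 := by
  obtain ⟨p, hp⟩ := CharP.exists K
  rcases CharP.char_is_prime_or_zero K p with hprime | rfl
  · obtain ⟨k, m, hm, rfl⟩ := Nat.exists_eq_pow_mul_and_not_dvd hn p hprime.ne_one
    refine ⟨p ^ k, m, rfl, fun h => hm ((CharP.cast_eq_zero_iff K p m).1 h), fun u hu => ?_⟩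
    rcases subsingleton_or_nontrivial L with hL | hL
    · exact Subsingleton.elim _ _
    have : Fact p.Prime := ⟨hprime⟩
    have : CharP (Module.End K L) p :=
      charP_of_injective_algebraMap (algebraMap K (Module.End K L)).injective p
    -- In characteristic `p`, `φ ^ p ^ k - 1 = (φ - 1) ^ p ^ k`, a power of an injective map.
    have h1 : ((φ - 1) ^ p ^ k) u = 0 := by
      rw [sub_pow_char_pow_of_commute p k (Commute.one_right φ), one_pow, LinearMap.sub_apply, hu,
        Module.End.one_apply, sub_self]
    have h2 : Function.Injective (φ - 1 : Module.End K L) := by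
      refine (injective_iff_map_eq_zero _).2 fun u hu => hfix u ?_
      rwa [LinearMap.sub_apply, sub_eq_zero, Module.End.one_apply] at hu
    have h3 : Function.Injective ((φ - 1 : Module.End K L) ^ p ^ k) := by
      rw [Module.End.coe_pow]
      exact h2.iterate _
    exact h3 (h1.trans (map_zero _).symm)
  · have := CharP.charP_to_charZero K
    exact ⟨1, n, (one_mul n).symm, Nat.cast_ne_zero.2 hn, by simpa using hfix⟩

end FrobeniusPair

/-! ### Application to Leibniz algebras. -/

section Leibniz

variable {K L : Type*} [Field K] [NonUnitalNonAssocRing L] [Module K L]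
  [IsScalarTower K L L] [SMulCommClass K L L]

/-- The map sending `y` to the right multiplication by `y`. -/
def rightMul (K L : Type*) [Field K] [NonUnitalNonAssocRing L] [Module K L]
    [IsScalarTower K L L] [SMulCommClass K L L] : L →ₗ[K] Module.End K L :=
  (LinearMap.mul K L).flip

theorem rightMul_apply (x y : L) : rightMul K L y x = x * y := rfl

theorem algebraLCS_le_span (k : ℕ) : algebraLCS K L k ≤ Submodule.span K
    {t | ∃ l : List L, l.length = k ∧ ∃ u, t = (l.map (rightMul K L)).prod u} := by
  induction k with
  | zero => exact fun u _ => Submodule.subset_span ⟨[], rfl, u, by simp⟩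
  | succ k ih =>
    refine Submodule.span_le.2 ?_
    rintro t ⟨x, hx, y, rfl⟩
    have hx' := ih hx
    clear hx
    rw [← rightMul_apply (K := K)]
    induction hx' using Submodule.span_induction with
    | zero => rw [map_zero]; exact zero_mem _
    | add _ _ _ _ h h' => rw [map_add]; exact add_mem h h'
    | smul t _ _ h => rw [map_smul]; exact Submodule.smul_mem _ _ h
    | mem t ht =>
      obtain ⟨l, hl, u, rfl⟩ := ht
      exact Submodule.subset_span ⟨y :: l, by simp [hl], u, by simp⟩

theorem prod_rightMul_mem_algebraLCS (C : NonUnitalSubalgebra K L) (l : List L)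
    (hl : ∀ x ∈ l, x ∈ C) (u : L) (hu : u ∈ C) :
    ∃ z ∈ algebraLCS K C l.length, (l.map (rightMul K L)).prod u = (z : L) := by
  induction l with
  | nil => exact ⟨⟨u, hu⟩, Submodule.mem_top, by simp⟩
  | cons x l ih =>
    rw [List.forall_mem_cons] at hl
    obtain ⟨z, hz, hzu⟩ := ih hl.2
    refine ⟨z * ⟨x, hl.1⟩, Submodule.subset_span ⟨z, hz, ⟨x, hl.1⟩, rfl⟩, ?_⟩
    rw [List.map_cons, List.prod_cons, Module.End.mul_apply, hzu, rightMul_apply]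
    rfl

theorem isNilpotentOfClassLE_of_isFrobeniusPair (hL : IsRightLeibniz L)
    {F H : Subgroup (algebraAut K L)} {q c : ℕ} (hFH : IsFrobeniusPair F H) (hF : IsCyclic F)
    (hq : Nat.card H = q) (hCF : fixedPointSubalgebra F = ⊥)
    (hCH : IsNilpotentOfClassLE K (fixedPointSubalgebra H) c) :
    IsNilpotentOfClassLE K L (nilpotencyBound q c) := by
  classical
  have := hFH.finite_kernel
  have := hFH.finite_complement
  have : Fintype H := Fintype.ofFinite H
  rw [Nat.card_eq_fintype_card] at hq
  subst hq
  obtain ⟨f, hf⟩ := hF.exists_generator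
  set φ : algebraAut K L := f.1 with hφdef
  have hmemF : ∀ ψ ∈ F, ∃ k : ℕ, φ ^ k = ψ := by
    intro ψ hψ
    obtain ⟨k, hk⟩ := (Submonoid.mem_powers_iff _ _).1
      (mem_powers_iff_mem_zpowers.2 (hf ⟨ψ, hψ⟩))
    exact ⟨k, by simpa using congrArg Subtype.val hk⟩
  have hφF : ∀ k : ℕ, φ ^ k ∈ F := fun k => F.pow_mem f.2 k
  have hord : orderOf φ ≠ 0 := by
    rw [hφdef, Subgroup.orderOf_coe]
    exact (orderOf_pos f).ne'
  have : NeZero (orderOf φ) := ⟨hord⟩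
  obtain ⟨χ, hχ⟩ := exists_monoidHom_zmod_orderOf φ H (by
    intro x hx
    have h1 : x⁻¹ * φ * x ∈ F := by
      have := (Subgroup.mem_normalizer_iff.1
        (H.inv_mem hx |> hFH.complement_le_normalizer)) φ
      simpa using this.1 f.2
    obtain ⟨k, hk⟩ := hmemF _ h1
    exact ⟨k, by rw [hk]; group⟩)
  have hunit := isUnit_sub_one_of_fixedPointFree φ hχ
    (fun m hm x hx hxm => hFH.fixedPointFree _ (hφF m) hm x hx hxm)
  let T : algebraAut K L →* Module.End K L :=
    LinearEquiv.automorphismGroup.toLinearMapMonoidHom.comp (algebraAut K L).subtype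
  have hT : ∀ (ψ : algebraAut K L) (x : L), T ψ x = (ψ : L ≃ₗ[K] L) x := fun _ _ => rfl
  have hTR : ∀ (ψ : algebraAut K L) (x u : L),
      T ψ (rightMul K L x u) = rightMul K L (T ψ x) (T ψ u) := fun ψ x u => ψ.2 u x
  have hfix : ∀ u, T φ u = u → u = 0 := by
    intro u hu
    have h1 : u ∈ fixedPointSubalgebra F := by
      intro ψ hψ
      obtain ⟨k, rfl⟩ := hmemF ψ hψ
      rw [← hT, map_pow, Module.End.coe_pow]
      exact Function.iterate_fixed hu k
    rw [hCF] at h1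
    exact NonUnitalAlgebra.mem_bot.1 h1
  obtain ⟨e, m, hem, hm, hfix'⟩ := exists_pow_fixedPointFree (T φ) hfix hord
  have : NeZero m := ⟨fun h => hm (by rw [h, Nat.cast_zero])⟩
  have hmn : m ∣ orderOf φ := ⟨e, by rw [hem, mul_comm]⟩
  have hψ : (φ ^ e) ^ m = 1 := by rw [← pow_mul, ← hem, pow_orderOf_eq_one]
  -- Replacing `φ` by `φ ^ e` of exponent `m` reduces the character modulo `m`; units stay units.
  let κ : ZMod (orderOf φ) →+* ZMod m := ZMod.castHom hmn (ZMod m)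
  have hκ : ∀ x : H, φ ^ e * x = x * (φ ^ e) ^ (κ (χ x)).val := by
    intro x
    have h1 : (κ (χ x)).val = (χ x).val % m := by
      rw [← ZMod.val_natCast, ← map_natCast κ, ZMod.natCast_zmod_val]
    rw [h1, ← pow_eq_pow_mod _ hψ, ← pow_mul, mul_comm e, pow_mul_eq_mul_pow_mul (hχ x)]
  have hlong := prod_rightMul_eq_zero_of_natCast_ne_zero (L := L) hm (H := H)
    (χ := (κ : ZMod (orderOf φ) →* ZMod m).comp χ) (ρ := T.comp H.subtype) (c := c)
    (fun x hx => by
      have := (hunit x hx).map κ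
      rwa [map_sub, map_one] at this)
    (R := rightMul K L)
    (fun x y => by
      ext z
      rw [LinearMap.sub_apply, Module.End.mul_apply, Module.End.mul_apply]
      simp only [rightMul_apply]
      rw [hL z x y, add_sub_cancel_right])
    (φ := T (φ ^ e)) (by rw [← map_pow, hψ, map_one]) (hTR _)
    (fun u hu => hfix' u (by rwa [map_pow] at hu)) (fun x => hTR x)
    (fun x => by
      change T (φ ^ e) * T x = T x * T (φ ^ e) ^ (κ (χ x)).val
      rw [← map_mul, hκ, map_mul, map_pow])
    (by
      intro l hl u
      -- Traces lie in `C_L(H)`, so a product of a trace with `c` further traces lies in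
      -- `γ_{c+1}(C_L(H)) = 0`.
      have htr : ∀ y : L, ∑ h : H, (T.comp H.subtype) h y ∈ fixedPointSubalgebra H := by
        intro y ψ hψ
        rw [← hT, map_sum]
        refine Fintype.sum_equiv (Equiv.mulLeft (⟨ψ, hψ⟩ : H)) _ _ fun h => ?_
        change T ψ (T h y) = T (ψ * h) y
        rw [map_mul, Module.End.mul_apply]
      obtain ⟨z, hz, hzu⟩ := prod_rightMul_mem_algebraLCS (fixedPointSubalgebra H)
        (l.map fun x => ∑ h : H, (T.comp H.subtype) h x) (by
          intro y hy
          obtain ⟨x, -, rfl⟩ := List.mem_map.1 hy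
          exact htr x) _ (htr u)
      rw [List.length_map, hl, show algebraLCS K (fixedPointSubalgebra H) c = ⊥ from hCH,
        Submodule.mem_bot] at hz
      rw [List.map_map, hz] at hzu
      exact hzu)
  refine le_bot_iff.1 ((algebraLCS_le_span _).trans (Submodule.span_le.2 ?_))
  rintro t ⟨l, hl, u, rfl⟩
  rw [hlong l hl]
  simp

end Leibniz

theorem mainTheorem2 :
    ∃ bound : ℕ → ℕ → ℕ,
      ∀ (K : Type*) (L : Type*) [Field K] [NonUnitalNonAssocRing L] [Module K L]
        [IsScalarTower K L L] [SMulCommClass K L L],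
        IsRightLeibniz L →
        ∀ (F H : Subgroup (algebraAut K L)) (q c : ℕ),
          IsFrobeniusPair F H →
          IsCyclic F →
          Nat.card H = q →
          fixedPointSubalgebra F = ⊥ →
          IsNilpotentOfClassLE K (fixedPointSubalgebra H) c →
          IsNilpotentOfClassLE K L (bound q c) :=
  ⟨nilpotencyBound, fun _ _ _ _ _ _ _ hL _ _ _ _ hFH hF hq hCF hCH =>
    isNilpotentOfClassLE_of_isFrobeniusPair hL hFH hF hq hCF hCH⟩
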